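/- **Setting (LFR: canonical LF with refinement types).** All syntax is taken up to renaming of bound variables. The grammar is atomic terms $R ::= c \mid x \mid R\,N$; normal terms $N ::= R \mid \lambda x.N$; atomic types $P ::= a \mid P\,N$; types $A ::= P \mid \Pi x{:}A_1.A_2$; kinds $K ::= \mathsf{type} \mid \Pi x{:}A.K$; atomic sorts $Q ::= s \mid Q\,N$; sorts $S ::= Q \mid \Pi x{::}S_1{\sqsubset}A_1.S_2 \mid \top \mid S_1\wedge S_2$; classes $L ::= \mathsf{sort} \mid \Pi x{::}S{\sqsubset}A.L \mid \top \mid L_1\wedge L_2$. A signature $\Sigma$ is a finite list of declarations $a:K$, $c:A$, $s\sqsubset a::L$, $s_1\le s_2$, $c::S$; a context $\Gamma$ is a finite list of declarations $x::S\sqsubset A$ of distinct variables. $\Sigma^*$ keeps the declarations $a:K$ and $c:A$ of $\Sigma$, and $\Gamma^*$ replaces each $x::S\sqsubset A$ by $x:A$. Simple types are $\alpha ::= a \mid \alpha_1\to\alpha_2$, with $|a\,N_1\cdots N_n|=a$ and $|\Pi x{:}A.B|=|A|\to|B|$. *Hereditary substitution* is the family of relations generated as follows (bound variables are renamed to avoid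 capture). Into atomic terms with head other than $x_0$: $[N_0/x_0]^{rr}_{\alpha_0}x=x$ for $x\ne x_0$, $[N_0/x_0]^{rr}_{\alpha_0}c=c$, and $[N_0/x_0]^{rr}_{\alpha_0}(R_1N_2)=R_1'N_2'$ if $[N_0/x_0]^{rr}_{\alpha_0}R_1=R_1'$ and $[N_0/x_0]^n_{\alpha_0}N_2=N_2'$. Into atomic terms with head $x_0$: $[N_0/x_0]^{rn}_{\alpha_0}x_0=(N_0,\alpha_0)$, and $[N_0/x_0]^{rn}_{\alpha_0}(R_1N_2)=(N_1',\alpha_1)$ if $[N_0/x_0]^{rn}_{\alpha_0}R_1=(\lambda x.N_1,\alpha_2\to\alpha_1)$, $[N_0/x_0]^n_{\alpha_0}N_2=N_2'$ and $[N_2'/x]^n_{\alpha_2}N_1=N_1'$. Into normal terms: $[N_0/x_0]^n_{\alpha_0}R=R'$ if $[N_0/x_0]^{rr}_{\alpha_0}R=R'$ or $[N_0/x_0]^{rn}_{\alpha_0}R=(R',a)$ with $R'$ atomic and $a$ a base type, and $[N_0/x_0]^n_{\alpha_0}\lambda x.N=\lambda x.N'$ if $[N_0/x_0]^n_{\alpha_0}N=N'$.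 On all other categories (atomic types and types, atomic sorts and sorts, kinds, classes, contexts) it is compositional. The index $A_0$ stands for $|A_0|$. *Canonical LF* (over $\Sigma^*$ and contexts of declarations $x:A$). $c\Rightarrow A$ if $c:A\in\Sigma^*$; $x\Rightarrow A$ if $x:A\in\Gamma$; $R\,N\Rightarrow[N/x]_{A}B$ (if defined) when $R\Rightarrow\Pi x{:}A.B$ and $N\Leftarrow A$; $R\Leftarrow P$ if $R\Rightarrow P$; $\lambda x.N\Leftarrow\Pi x{:}A.B$ if $\Gamma,x{:}A\vdash N\Leftarrow B$. Likewise $a\Rightarrow K$ if $a:K\in\Sigma^*$, and $P\,N\Rightarrow[N/x]_AK$ (if defined) when $P\Rightarrow\Pi x{:}A.K$ and $N\Leftarrow A$; $P\Leftarrow\mathsf{type}$ if $P\Rightarrow\mathsf{type}$; $\Pi x{:}A.B\Leftarrow\mathsf{type}$ if $A\Leftarrow\mathsf{type}$ and $\Gamma,x{:}A\vdash B\Leftarrow\mathsf{type}$; $\mathsf{type}\Leftarrow\mathsf{kind}$, and $\Pi x{:}A.K\Leftarrow\mathsf{kind}$ if $A\Leftarrow\mathsf{type}$ and $\Gamma,x{:}A\vdash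 K\Leftarrow\mathsf{kind}$. An LF context is well-formed if each type in it is a well-formed type in the context before it. *Refinements* (over $\Sigma$). Subsorting $\le$ on atomic sorts is the reflexive-transitive closure of $s_1N_1\cdots N_n\le s_2N_1\cdots N_n$ for $s_1\le s_2\in\Sigma$. Sort synthesis: $c\Rightarrow S$ if $c::S\in\Sigma$; $x\Rightarrow S$ if $x::S\sqsubset A\in\Gamma$; $R\,N\Rightarrow[N/x]_AT$ (if defined) when $R\Rightarrow\Pi x{::}S{\sqsubset}A.T$ and $N\Leftarrow S$; $R\Rightarrow S_i$ if $R\Rightarrow S_1\wedge S_2$. Sort checking: $R\Leftarrow Q$ if $R\Rightarrow Q'$ and $Q'\le Q$; $\lambda x.N\Leftarrow\Pi x{::}S{\sqsubset}A.T$ if $\Gamma,x{::}S{\sqsubset}A\vdash N\Leftarrow T$; always $N\Leftarrow\top$; $N\Leftarrow S_1\wedge S_2$ if $N\Leftarrow S_1$ and $N\Leftarrow S_2$. Class synthesis: $s\sqsubset a\Rightarrow L$ if $s\sqsubset a::L\in\Sigma$; $Q\,N\sqsubset P\,N\Rightarrow[N/x]_AL$ (if defined) when $Q\sqsubset P\Rightarrow\Pi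 x{::}S{\sqsubset}A.L$ and $N\Leftarrow S$; $Q\sqsubset P\Rightarrow L_i$ if $Q\sqsubset P\Rightarrow L_1\wedge L_2$. Sort formation: $Q\sqsubset P$ if $Q\sqsubset P\Rightarrow\mathsf{sort}$; $\Pi x{::}S{\sqsubset}A.S'\sqsubset\Pi x{:}A.A'$ if $S\sqsubset A$ and $\Gamma,x{::}S{\sqsubset}A\vdash S'\sqsubset A'$; always $\top\sqsubset A$; $S_1\wedge S_2\sqsubset A$ if $S_1\sqsubset A$ and $S_2\sqsubset A$. Class formation $L\sqsubset K$ is analogous: $\mathsf{sort}\sqsubset\mathsf{type}$, $\Pi x{::}S{\sqsubset}A.L\sqsubset\Pi x{:}A.K$ if $S\sqsubset A$ and $\Gamma,x{::}S{\sqsubset}A\vdash L\sqsubset K$, $\top\sqsubset K$, and $L_1\wedge L_2\sqsubset K$ if $L_1\sqsubset K$ and $L_2\sqsubset K$. A context is well-formed ($\vdash\Gamma\ \mathsf{ctx}$) if for each $x::S\sqsubset A$ in it $S\sqsubset A$ holds in the context before it. $\Sigma$ is well-formed if each declaration is well-formed in the signature before it and the empty context: for $a:K$, $K\Leftarrow\mathsf{kind}$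 (in LF) and $a$ has no earlier kind declaration; for $c:A$, $A\Leftarrow\mathsf{type}$ (in LF) and $c$ has no earlier type declaration; for $s\sqsubset a::L$, some $a:K$ is declared with $L\sqsubset K$, and $s$ is not yet declared; for $c::S$, some $c:A$ is declared with $S\sqsubset A$, and $c$ has no earlier sort declaration; for $s_1\le s_2$, both $s_1\sqsubset a::L$ and $s_2\sqsubset a::L$ are declared for some $a$, $L$. **Theorem (Substitution).** Let $\Sigma$ be a well-formed signature. Write $\Gamma=\Gamma_L,\,x_0{::}S_0{\sqsubset}A_0,\,\Gamma_R$ and suppose $\Gamma_L\vdash N_0\Leftarrow S_0$ and $\Gamma_L^*\vdash N_0\Leftarrow A_0$, and $\vdash\Gamma\ \mathsf{ctx}$ and $\Gamma^*$ is a well-formed LF context. Then there is $\Gamma_R'$ with $[N_0/x_0]_{A_0}\Gamma_R=\Gamma_R'$ such that $\vdash\Gamma'\ \mathsf{ctx}$ and $\Gamma'^*$ is a well-formed LF context, where $\Gamma'=\Gamma_L,\Gamma_R'$, and moreover: 1. (Normal terms) If $\Gamma\vdash S\sqsubset A$ and $\Gamma^*\vdash A\Leftarrow\mathsf{type}$,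 and $\Gamma\vdash N\Leftarrow S$ and $\Gamma^*\vdash N\Leftarrow A$, then there are $S',A',N'$ with $[N_0/x_0]_{A_0}S=S'$, $[N_0/x_0]_{A_0}A=A'$, $[N_0/x_0]^n_{A_0}N=N'$, and $\Gamma'\vdash S'\sqsubset A'$, $\Gamma'^*\vdash A'\Leftarrow\mathsf{type}$, $\Gamma'\vdash N'\Leftarrow S'$, $\Gamma'^*\vdash N'\Leftarrow A'$. 2. (Atomic terms) If $\Gamma\vdash R\Rightarrow S$ and $\Gamma^*\vdash R\Rightarrow A$, then there are $S',A'$ with $[N_0/x_0]_{A_0}S=S'$ and $[N_0/x_0]_{A_0}A=A'$, and either $[N_0/x_0]^{rr}_{A_0}R=R'$ for some $R'$ with $\Gamma'\vdash R'\Rightarrow S'$ and $\Gamma'^*\vdash R'\Rightarrow A'$, or $[N_0/x_0]^{rn}_{A_0}R=(N',|A'|)$ for some $N'$ with $\Gamma'\vdash N'\Leftarrow S'$ and $\Gamma'^*\vdash N'\Leftarrow A'$. 3. (Sorts and types) If $\Gamma\vdash S\sqsubset A$ and $\Gamma^*\vdash A\Leftarrow\mathsf{type}$, then there are $S',A'$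 with $[N_0/x_0]_{A_0}S=S'$, $[N_0/x_0]_{A_0}A=A'$, $\Gamma'\vdash S'\sqsubset A'$ and $\Gamma'^*\vdash A'\Leftarrow\mathsf{type}$. 4. (Atomic sorts and types) If $\Gamma\vdash Q\sqsubset P\Rightarrow L$ and $\Gamma^*\vdash P\Rightarrow K$, then there are $Q',P',L',K'$ that are the results of $[N_0/x_0]_{A_0}$ on $Q,P,L,K$, and $\Gamma'\vdash Q'\sqsubset P'\Rightarrow L'$ and $\Gamma'^*\vdash P'\Rightarrow K'$. 5. (Classes and kinds) If $\Gamma\vdash L\sqsubset K$ and $\Gamma^*\vdash K\Leftarrow\mathsf{kind}$, then there are $L',K'$ with $[N_0/x_0]_{A_0}L=L'$, $[N_0/x_0]_{A_0}K=K'$, $\Gamma'\vdash L'\sqsubset K'$ and $\Gamma'^*\vdash K'\Leftarrow\mathsf{kind}$. -/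

import Mathlib

/-!
LF with refinement types (LFR), in canonical form, together with the underlying canonical LF.

Terms are taken up to renaming of bound variables by means of de Bruijn indices: index `0` is the
innermost binder (or the last declaration of the context).  Contexts are lists whose head is the
*last* declaration, so the context `Γ_L, x₀::S₀⊏A₀, Γ_R` is `ΓR ++ (S₀, A₀) :: ΓL`, and in it the
variable `x₀` has index `ΓR.length`.
-/

namespace LFR

/-! ### Grammar -/

/-- Names of type family constants `a`. -/
abbrev TyConst := ℕ

/-- Names of term constants `c`. -/
abbrev TmConst := ℕ

/-- Names of sort family constants `s`. -/
abbrev SrtConst := ℕ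

mutual
  /-- Atomic terms `R ::= c | x | R N`. -/
  inductive Atm : Type where
    | const (c : TmConst) : Atm
    | var (i : ℕ) : Atm
    | app (R : Atm) (N : Nrm) : Atm
  /-- Normal terms `N ::= R | λx. N`. -/
  inductive Nrm : Type where
    | atm (R : Atm) : Nrm
    | lam (N : Nrm) : Nrm
end

/-- Atomic type families `P ::= a | P N`. -/
inductive ATy : Type where
  | const (a : TyConst) : ATy
  | app (P : ATy) (N : Nrm) : ATy

/-- Normal type families `A ::= P | Πx:A₁. A₂`. -/
inductive Ty : Type where
  | atm (P : ATy) : Ty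
  | pi (A₁ A₂ : Ty) : Ty

/-- Kinds `K ::= type | Πx:A. K`. -/
inductive Kind : Type where
  | type : Kind
  | pi (A : Ty) (K : Kind) : Kind

/-- Atomic sort families `Q ::= s | Q N`. -/
inductive ASrt : Type where
  | const (s : SrtConst) : ASrt
  | app (Q : ASrt) (N : Nrm) : ASrt

/-- Normal sort families `S ::= Q | Πx::S₁⊏A₁. S₂ | ⊤ | S₁ ∧ S₂`. -/
inductive Srt : Type where
  | atm (Q : ASrt) : Srt
  | pi (S₁ : Srt) (A₁ : Ty) (S₂ : Srt) : Srt
  | top : Srt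
  | inter (S₁ S₂ : Srt) : Srt

/-- Classes `L ::= sort | Πx::S⊏A. L | ⊤ | L₁ ∧ L₂`. -/
inductive Cls : Type where
  | sort : Cls
  | pi (S : Srt) (A : Ty) (L : Cls) : Cls
  | top : Cls
  | inter (L₁ L₂ : Cls) : Cls

/-- Declarations of an LF signature: `a : K` and `c : A`. -/
inductive LFDecl : Type where
  | ty (a : TyConst) (K : Kind) : LFDecl
  | tm (c : TmConst) (A : Ty) : LFDecl

/-- LF signatures; the head of the list is the last declaration. -/
abbrev LFSig := List LFDecl

/-- Declarations of an LFR signature: `a : K`, `c : A`, `s ⊏ a :: L`, `s₁ ≤ s₂` and `c :: S`. -/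
inductive Decl : Type where
  | ty (a : TyConst) (K : Kind) : Decl
  | tm (c : TmConst) (A : Ty) : Decl
  | srt (s : SrtConst) (a : TyConst) (L : Cls) : Decl
  | sub (s₁ s₂ : SrtConst) : Decl
  | tmSrt (c : TmConst) (S : Srt) : Decl

/-- LFR signatures; the head of the list is the last declaration. -/
abbrev Sig := List Decl

/-- LF contexts, declaring `x : A`; the head of the list is the last declaration. -/
abbrev LFCtx := List Ty

/-- LFR contexts, declaring `x :: S ⊏ A`; the head of the list is the last declaration. -/
abbrev Ctx := List (Srt × Ty)

/-- The LF declaration contained in an LFR declaration, if any. -/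
def Decl.erase : Decl → Option LFDecl
  | .ty a K => some (.ty a K)
  | .tm c A => some (.tm c A)
  | .srt _ _ _ => none
  | .sub _ _ => none
  | .tmSrt _ _ => none

/-- The LF signature `Σ*` underlying an LFR signature. -/
def Sig.erase (Sg : Sig) : LFSig := Sg.filterMap Decl.erase

/-- The LF context `Γ*` underlying an LFR context. -/
def Ctx.erase (Γ : Ctx) : LFCtx := Γ.map Prod.snd

/-! ### Renaming and weakening -/

/-- Extension of a renaming under one binder. -/
def upRen (ρ : ℕ → ℕ) : ℕ → ℕ
  | 0 => 0
  | i + 1 => ρ i + 1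

mutual
  def Atm.ren (ρ : ℕ → ℕ) : Atm → Atm
    | .const c => .const c
    | .var i => .var (ρ i)
    | .app R N => .app (R.ren ρ) (N.ren ρ)
  def Nrm.ren (ρ : ℕ → ℕ) : Nrm → Nrm
    | .atm R => .atm (R.ren ρ)
    | .lam N => .lam (N.ren (upRen ρ))
end

def ATy.ren (ρ : ℕ → ℕ) : ATy → ATy
  | .const a => .const a
  | .app P N => .app (P.ren ρ) (N.ren ρ)

def Ty.ren (ρ : ℕ → ℕ) : Ty → Ty
  | .atm P => .atm (P.ren ρ)
  | .pi A₁ A₂ => .pi (A₁.ren ρ) (A₂.ren (upRen ρ))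

def ASrt.ren (ρ : ℕ → ℕ) : ASrt → ASrt
  | .const s => .const s
  | .app Q N => .app (Q.ren ρ) (N.ren ρ)

def Srt.ren (ρ : ℕ → ℕ) : Srt → Srt
  | .atm Q => .atm (Q.ren ρ)
  | .pi S₁ A₁ S₂ => .pi (S₁.ren ρ) (A₁.ren ρ) (S₂.ren (upRen ρ))
  | .top => .top
  | .inter S₁ S₂ => .inter (S₁.ren ρ) (S₂.ren ρ)

/-- Weakening of a normal term by `n` variables. -/
def Nrm.shift (n : ℕ) (N : Nrm) : Nrm := N.ren (· + n)

/-- Weakening of a type by `n` variables. -/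
def Ty.shift (n : ℕ) (A : Ty) : Ty := A.ren (· + n)

/-- Weakening of a sort by `n` variables. -/
def Srt.shift (n : ℕ) (S : Srt) : Srt := S.ren (· + n)

/-! ### Simple types and erasure of dependencies -/

/-- Simple types `α ::= a | α₁ → α₂`. -/
inductive STy : Type where
  | base (a : TyConst) : STy
  | arrow (α₁ α₂ : STy) : STy

/-- The head constant of an atomic type family. -/
def ATy.head : ATy → TyConst
  | .const a => a
  | .app P _ => P.head

/-- The simple type `|A|` underlying the type `A`. -/
def Ty.simple : Ty → STy
  | .atm P => .base P.head
  | .pi A₁ A₂ => .arrow A₁.simple A₂.simple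

/-! ### Hereditary substitution

In `HSubstN N₀ k α₀ N N'` (and similarly for the other categories) the variable `x₀` that is
replaced has index `k` in the subject `N`.  The term `N₀` lives in the context to the left of `x₀`,
so it is weakened by `k` where it is put in place of `x₀`, and the indices of the variables to the
left of `x₀` drop by one. -/

mutual
  /-- `[N₀/x₀]ⁿ_α₀ N = N'`. -/
  inductive HSubstN : Nrm → ℕ → STy → Nrm → Nrm → Prop where
    | atm {N₀ : Nrm} {k : ℕ} {α₀ : STy} {R R' : Atm} :
        HSubstRR N₀ k α₀ R R' → HSubstN N₀ k α₀ (.atm R) (.atm R')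
    | atmNorm {N₀ : Nrm} {k : ℕ} {α₀ : STy} {R R' : Atm} {a : TyConst} :
        HSubstRN N₀ k α₀ R (.atm R') (.base a) → HSubstN N₀ k α₀ (.atm R) (.atm R')
    | lam {N₀ : Nrm} {k : ℕ} {α₀ : STy} {N N' : Nrm} :
        HSubstN N₀ (k + 1) α₀ N N' → HSubstN N₀ k α₀ (.lam N) (.lam N')
  /-- `[N₀/x₀]ʳʳ_α₀ R = R'`: substitution into an atomic term with a head other than `x₀`. -/
  inductive HSubstRR : Nrm → ℕ → STy → Atm → Atm → Prop where
    | varLt {N₀ : Nrm} {k : ℕ} {α₀ : STy} {i : ℕ} :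
        i < k → HSubstRR N₀ k α₀ (.var i) (.var i)
    | varGt {N₀ : Nrm} {k : ℕ} {α₀ : STy} {i : ℕ} :
        k ≤ i → HSubstRR N₀ k α₀ (.var (i + 1)) (.var i)
    | const {N₀ : Nrm} {k : ℕ} {α₀ : STy} {c : TmConst} :
        HSubstRR N₀ k α₀ (.const c) (.const c)
    | app {N₀ : Nrm} {k : ℕ} {α₀ : STy} {R₁ R₁' : Atm} {N₂ N₂' : Nrm} :
        HSubstRR N₀ k α₀ R₁ R₁' → HSubstN N₀ k α₀ N₂ N₂' →
        HSubstRR N₀ k α₀ (.app R₁ N₂) (.app R₁' N₂')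
  /-- `[N₀/x₀]ʳⁿ_α₀ R = (N', α')`: substitution into an atomic term with head `x₀`. -/
  inductive HSubstRN : Nrm → ℕ → STy → Atm → Nrm → STy → Prop where
    | var {N₀ : Nrm} {k : ℕ} {α₀ : STy} :
        HSubstRN N₀ k α₀ (.var k) (N₀.shift k) α₀
    | beta {N₀ : Nrm} {k : ℕ} {α₀ : STy} {R₁ : Atm} {N₁ N₂ N₂' N₁' : Nrm} {α₁ α₂ : STy} :
        HSubstRN N₀ k α₀ R₁ (.lam N₁) (.arrow α₂ α₁) →
        HSubstN N₀ k α₀ N₂ N₂' →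
        HSubstN N₂' 0 α₂ N₁ N₁' →
        HSubstRN N₀ k α₀ (.app R₁ N₂) N₁' α₁
end

/-- `[N₀/x₀]ᵖ_α₀ P = P'`. -/
inductive HSubstP : Nrm → ℕ → STy → ATy → ATy → Prop where
  | const {N₀ : Nrm} {k : ℕ} {α₀ : STy} {a : TyConst} :
      HSubstP N₀ k α₀ (.const a) (.const a)
  | app {N₀ : Nrm} {k : ℕ} {α₀ : STy} {P P' : ATy} {N N' : Nrm} :
      HSubstP N₀ k α₀ P P' → HSubstN N₀ k α₀ N N' → HSubstP N₀ k α₀ (.app P N) (.app P' N')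

/-- `[N₀/x₀]ᵃ_α₀ A = A'`. -/
inductive HSubstA : Nrm → ℕ → STy → Ty → Ty → Prop where
  | atm {N₀ : Nrm} {k : ℕ} {α₀ : STy} {P P' : ATy} :
      HSubstP N₀ k α₀ P P' → HSubstA N₀ k α₀ (.atm P) (.atm P')
  | pi {N₀ : Nrm} {k : ℕ} {α₀ : STy} {A₁ A₁' A₂ A₂' : Ty} :
      HSubstA N₀ k α₀ A₁ A₁' → HSubstA N₀ (k + 1) α₀ A₂ A₂' →
      HSubstA N₀ k α₀ (.pi A₁ A₂) (.pi A₁' A₂')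

/-- `[N₀/x₀]ᵏ_α₀ K = K'`. -/
inductive HSubstK : Nrm → ℕ → STy → Kind → Kind → Prop where
  | type {N₀ : Nrm} {k : ℕ} {α₀ : STy} : HSubstK N₀ k α₀ .type .type
  | pi {N₀ : Nrm} {k : ℕ} {α₀ : STy} {A A' : Ty} {K K' : Kind} :
      HSubstA N₀ k α₀ A A' → HSubstK N₀ (k + 1) α₀ K K' →
      HSubstK N₀ k α₀ (.pi A K) (.pi A' K')

/-- `[N₀/x₀]^q_α₀ Q = Q'`. -/
inductive HSubstQ : Nrm → ℕ → STy → ASrt → ASrt → Prop where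
  | const {N₀ : Nrm} {k : ℕ} {α₀ : STy} {s : SrtConst} :
      HSubstQ N₀ k α₀ (.const s) (.const s)
  | app {N₀ : Nrm} {k : ℕ} {α₀ : STy} {Q Q' : ASrt} {N N' : Nrm} :
      HSubstQ N₀ k α₀ Q Q' → HSubstN N₀ k α₀ N N' → HSubstQ N₀ k α₀ (.app Q N) (.app Q' N')

/-- `[N₀/x₀]ˢ_α₀ S = S'`. -/
inductive HSubstS : Nrm → ℕ → STy → Srt → Srt → Prop where
  | atm {N₀ : Nrm} {k : ℕ} {α₀ : STy} {Q Q' : ASrt} :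
      HSubstQ N₀ k α₀ Q Q' → HSubstS N₀ k α₀ (.atm Q) (.atm Q')
  | pi {N₀ : Nrm} {k : ℕ} {α₀ : STy} {S₁ S₁' : Srt} {A₁ A₁' : Ty} {S₂ S₂' : Srt} :
      HSubstS N₀ k α₀ S₁ S₁' → HSubstA N₀ k α₀ A₁ A₁' → HSubstS N₀ (k + 1) α₀ S₂ S₂' →
      HSubstS N₀ k α₀ (.pi S₁ A₁ S₂) (.pi S₁' A₁' S₂')
  | top {N₀ : Nrm} {k : ℕ} {α₀ : STy} : HSubstS N₀ k α₀ .top .top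
  | inter {N₀ : Nrm} {k : ℕ} {α₀ : STy} {S₁ S₁' S₂ S₂' : Srt} :
      HSubstS N₀ k α₀ S₁ S₁' → HSubstS N₀ k α₀ S₂ S₂' →
      HSubstS N₀ k α₀ (.inter S₁ S₂) (.inter S₁' S₂')

/-- `[N₀/x₀]ˡ_α₀ L = L'`. -/
inductive HSubstL : Nrm → ℕ → STy → Cls → Cls → Prop where
  | sort {N₀ : Nrm} {k : ℕ} {α₀ : STy} : HSubstL N₀ k α₀ .sort .sort
  | pi {N₀ : Nrm} {k : ℕ} {α₀ : STy} {S S' : Srt} {A A' : Ty} {L L' : Cls} :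
      HSubstS N₀ k α₀ S S' → HSubstA N₀ k α₀ A A' → HSubstL N₀ (k + 1) α₀ L L' →
      HSubstL N₀ k α₀ (.pi S A L) (.pi S' A' L')
  | top {N₀ : Nrm} {k : ℕ} {α₀ : STy} : HSubstL N₀ k α₀ .top .top
  | inter {N₀ : Nrm} {k : ℕ} {α₀ : STy} {L₁ L₁' L₂ L₂' : Cls} :
      HSubstL N₀ k α₀ L₁ L₁' → HSubstL N₀ k α₀ L₂ L₂' →
      HSubstL N₀ k α₀ (.inter L₁ L₂) (.inter L₁' L₂')

/-- `[N₀/x₀]^γ_α₀ Γ = Γ'`, where `Γ` is the part of the context to the right of `x₀`. -/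
inductive HSubstCtx : Nrm → STy → Ctx → Ctx → Prop where
  | nil {N₀ : Nrm} {α₀ : STy} : HSubstCtx N₀ α₀ [] []
  | cons {N₀ : Nrm} {α₀ : STy} {Γ Γ' : Ctx} {S S' : Srt} {A A' : Ty} :
      HSubstCtx N₀ α₀ Γ Γ' → HSubstS N₀ Γ.length α₀ S S' → HSubstA N₀ Γ.length α₀ A A' →
      HSubstCtx N₀ α₀ ((S, A) :: Γ) ((S', A') :: Γ')

/-! ### Canonical LF -/

mutual
  /-- `Γ ⊢ R ⇒ A`: the atomic term `R` synthesizes the type `A`. -/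
  inductive LFSynth : LFSig → LFCtx → Atm → Ty → Prop where
    | const {Sg : LFSig} {Γ : LFCtx} {c : TmConst} {A : Ty} :
        LFDecl.tm c A ∈ Sg → LFSynth Sg Γ (.const c) A
    | var {Sg : LFSig} {Γ : LFCtx} {i : ℕ} {A : Ty} :
        Γ[i]? = some A → LFSynth Sg Γ (.var i) (A.shift (i + 1))
    | app {Sg : LFSig} {Γ : LFCtx} {R₁ : Atm} {N₂ : Nrm} {A₂ A A' : Ty} :
        LFSynth Sg Γ R₁ (.pi A₂ A) → LFCheck Sg Γ N₂ A₂ → HSubstA N₂ 0 A₂.simple A A' →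
        LFSynth Sg Γ (.app R₁ N₂) A'
  /-- `Γ ⊢ N ⇐ A`: the normal term `N` checks against the type `A`. -/
  inductive LFCheck : LFSig → LFCtx → Nrm → Ty → Prop where
    | atm {Sg : LFSig} {Γ : LFCtx} {R : Atm} {P : ATy} :
        LFSynth Sg Γ R (.atm P) → LFCheck Sg Γ (.atm R) (.atm P)
    | lam {Sg : LFSig} {Γ : LFCtx} {N : Nrm} {A B : Ty} :
        LFCheck Sg (A :: Γ) N B → LFCheck Sg Γ (.lam N) (.pi A B)
end

/-- `Γ ⊢ P ⇒ K`: the atomic type family `P` synthesizes the kind `K`. -/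
inductive LFSynthKind : LFSig → LFCtx → ATy → Kind → Prop where
  | const {Sg : LFSig} {Γ : LFCtx} {a : TyConst} {K : Kind} :
      LFDecl.ty a K ∈ Sg → LFSynthKind Sg Γ (.const a) K
  | app {Sg : LFSig} {Γ : LFCtx} {P : ATy} {N : Nrm} {A : Ty} {K K' : Kind} :
      LFSynthKind Sg Γ P (.pi A K) → LFCheck Sg Γ N A → HSubstK N 0 A.simple K K' →
      LFSynthKind Sg Γ (.app P N) K'

/-- `Γ ⊢ A ⇐ type`: `A` is a well-formed type. -/
inductive LFTyWf : LFSig → LFCtx → Ty → Prop where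
  | atm {Sg : LFSig} {Γ : LFCtx} {P : ATy} :
      LFSynthKind Sg Γ P .type → LFTyWf Sg Γ (.atm P)
  | pi {Sg : LFSig} {Γ : LFCtx} {A₁ A₂ : Ty} :
      LFTyWf Sg Γ A₁ → LFTyWf Sg (A₁ :: Γ) A₂ → LFTyWf Sg Γ (.pi A₁ A₂)

/-- `Γ ⊢ K ⇐ kind`: `K` is a well-formed kind. -/
inductive LFKindWf : LFSig → LFCtx → Kind → Prop where
  | type {Sg : LFSig} {Γ : LFCtx} : LFKindWf Sg Γ .type
  | pi {Sg : LFSig} {Γ : LFCtx} {A : Ty} {K : Kind} :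
      LFTyWf Sg Γ A → LFKindWf Sg (A :: Γ) K → LFKindWf Sg Γ (.pi A K)

/-- `⊢ Γ ctx`, for LF contexts. -/
inductive LFCtxWf : LFSig → LFCtx → Prop where
  | nil {Sg : LFSig} : LFCtxWf Sg []
  | cons {Sg : LFSig} {Γ : LFCtx} {A : Ty} :
      LFCtxWf Sg Γ → LFTyWf Sg Γ A → LFCtxWf Sg (A :: Γ)

/-! ### LF with refinements -/

/-- One declared step of subsorting between atomic sorts: `s₁ N⃗ ≤ s₂ N⃗` for `s₁ ≤ s₂` in `Σ`. -/
inductive SubStep : Sig → ASrt → ASrt → Prop where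
  | decl {Sg : Sig} {s₁ s₂ : SrtConst} :
      Decl.sub s₁ s₂ ∈ Sg → SubStep Sg (.const s₁) (.const s₂)
  | app {Sg : Sig} {Q₁ Q₂ : ASrt} {N : Nrm} :
      SubStep Sg Q₁ Q₂ → SubStep Sg (.app Q₁ N) (.app Q₂ N)

/-- Subsorting `Q₁ ≤ Q₂` between atomic sorts. -/
inductive Subsort : Sig → ASrt → ASrt → Prop where
  | refl {Sg : Sig} {Q : ASrt} : Subsort Sg Q Q
  | step {Sg : Sig} {Q₁ Q' Q₂ : ASrt} :
      SubStep Sg Q₁ Q' → Subsort Sg Q' Q₂ → Subsort Sg Q₁ Q₂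

mutual
  /-- `Γ ⊢ R ⇒ S`: the atomic term `R` synthesizes the sort `S`. -/
  inductive Synth : Sig → Ctx → Atm → Srt → Prop where
    | const {Sg : Sig} {Γ : Ctx} {c : TmConst} {S : Srt} :
        Decl.tmSrt c S ∈ Sg → Synth Sg Γ (.const c) S
    | var {Sg : Sig} {Γ : Ctx} {i : ℕ} {S : Srt} {A : Ty} :
        Γ[i]? = some (S, A) → Synth Sg Γ (.var i) (S.shift (i + 1))
    | app {Sg : Sig} {Γ : Ctx} {R₁ : Atm} {N₂ : Nrm} {S₂ S S' : Srt} {A₂ : Ty} :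
        Synth Sg Γ R₁ (.pi S₂ A₂ S) → Check Sg Γ N₂ S₂ → HSubstS N₂ 0 A₂.simple S S' →
        Synth Sg Γ (.app R₁ N₂) S'
    | interE₁ {Sg : Sig} {Γ : Ctx} {R : Atm} {S₁ S₂ : Srt} :
        Synth Sg Γ R (.inter S₁ S₂) → Synth Sg Γ R S₁
    | interE₂ {Sg : Sig} {Γ : Ctx} {R : Atm} {S₁ S₂ : Srt} :
        Synth Sg Γ R (.inter S₁ S₂) → Synth Sg Γ R S₂
  /-- `Γ ⊢ N ⇐ S`: the normal term `N` checks against the sort `S`. -/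
  inductive Check : Sig → Ctx → Nrm → Srt → Prop where
    | switch {Sg : Sig} {Γ : Ctx} {R : Atm} {Q' Q : ASrt} :
        Synth Sg Γ R (.atm Q') → Subsort Sg Q' Q → Check Sg Γ (.atm R) (.atm Q)
    | lam {Sg : Sig} {Γ : Ctx} {N : Nrm} {S S' : Srt} {A : Ty} :
        Check Sg ((S, A) :: Γ) N S' → Check Sg Γ (.lam N) (.pi S A S')
    | top {Sg : Sig} {Γ : Ctx} {N : Nrm} : Check Sg Γ N .top
    | inter {Sg : Sig} {Γ : Ctx} {N : Nrm} {S₁ S₂ : Srt} :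
        Check Sg Γ N S₁ → Check Sg Γ N S₂ → Check Sg Γ N (.inter S₁ S₂)
end

/-- `Γ ⊢ Q ⊏ P ⇒ L`: the atomic sort family `Q` refines `P` and synthesizes the class `L`. -/
inductive SynthCls : Sig → Ctx → ASrt → ATy → Cls → Prop where
  | const {Sg : Sig} {Γ : Ctx} {s : SrtConst} {a : TyConst} {L : Cls} :
      Decl.srt s a L ∈ Sg → SynthCls Sg Γ (.const s) (.const a) L
  | app {Sg : Sig} {Γ : Ctx} {Q : ASrt} {P : ATy} {N : Nrm} {S : Srt} {A : Ty} {L L' : Cls} :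
      SynthCls Sg Γ Q P (.pi S A L) → Check Sg Γ N S → HSubstL N 0 A.simple L L' →
      SynthCls Sg Γ (.app Q N) (.app P N) L'
  | interE₁ {Sg : Sig} {Γ : Ctx} {Q : ASrt} {P : ATy} {L₁ L₂ : Cls} :
      SynthCls Sg Γ Q P (.inter L₁ L₂) → SynthCls Sg Γ Q P L₁
  | interE₂ {Sg : Sig} {Γ : Ctx} {Q : ASrt} {P : ATy} {L₁ L₂ : Cls} :
      SynthCls Sg Γ Q P (.inter L₁ L₂) → SynthCls Sg Γ Q P L₂

/-- `Γ ⊢ S ⊏ A`: `S` is a well-formed sort refining the type `A`. -/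
inductive Refines : Sig → Ctx → Srt → Ty → Prop where
  | atm {Sg : Sig} {Γ : Ctx} {Q : ASrt} {P : ATy} :
      SynthCls Sg Γ Q P .sort → Refines Sg Γ (.atm Q) (.atm P)
  | pi {Sg : Sig} {Γ : Ctx} {S S' : Srt} {A A' : Ty} :
      Refines Sg Γ S A → Refines Sg ((S, A) :: Γ) S' A' →
      Refines Sg Γ (.pi S A S') (.pi A A')
  | top {Sg : Sig} {Γ : Ctx} {A : Ty} : Refines Sg Γ .top A
  | inter {Sg : Sig} {Γ : Ctx} {S₁ S₂ : Srt} {A : Ty} :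
      Refines Sg Γ S₁ A → Refines Sg Γ S₂ A → Refines Sg Γ (.inter S₁ S₂) A

/-- `Γ ⊢ L ⊏ K`: `L` is a well-formed class refining the kind `K`. -/
inductive RefinesCls : Sig → Ctx → Cls → Kind → Prop where
  | sort {Sg : Sig} {Γ : Ctx} : RefinesCls Sg Γ .sort .type
  | pi {Sg : Sig} {Γ : Ctx} {S : Srt} {A : Ty} {L : Cls} {K : Kind} :
      Refines Sg Γ S A → RefinesCls Sg ((S, A) :: Γ) L K →
      RefinesCls Sg Γ (.pi S A L) (.pi A K)
  | top {Sg : Sig} {Γ : Ctx} {K : Kind} : RefinesCls Sg Γ .top K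
  | inter {Sg : Sig} {Γ : Ctx} {L₁ L₂ : Cls} {K : Kind} :
      RefinesCls Sg Γ L₁ K → RefinesCls Sg Γ L₂ K → RefinesCls Sg Γ (.inter L₁ L₂) K

/-- `⊢ Γ ctx`, for LFR contexts. -/
inductive CtxWf : Sig → Ctx → Prop where
  | nil {Sg : Sig} : CtxWf Sg []
  | cons {Sg : Sig} {Γ : Ctx} {S : Srt} {A : Ty} :
      CtxWf Sg Γ → Refines Sg Γ S A → CtxWf Sg ((S, A) :: Γ)

/-- `⊢ Σ sig`: well-formed LFR signatures. -/
inductive SigWf : Sig → Prop where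
  | nil : SigWf []
  | ty {Sg : Sig} {a : TyConst} {K : Kind} :
      SigWf Sg → LFKindWf (Sig.erase Sg) [] K → (∀ K', Decl.ty a K' ∉ Sg) →
      SigWf (.ty a K :: Sg)
  | tm {Sg : Sig} {c : TmConst} {A : Ty} :
      SigWf Sg → LFTyWf (Sig.erase Sg) [] A → (∀ A', Decl.tm c A' ∉ Sg) →
      SigWf (.tm c A :: Sg)
  | srt {Sg : Sig} {s : SrtConst} {a : TyConst} {K : Kind} {L : Cls} :
      SigWf Sg → Decl.ty a K ∈ Sg → RefinesCls Sg [] L K →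
      (∀ a' L', Decl.srt s a' L' ∉ Sg) → SigWf (.srt s a L :: Sg)
  | tmSrt {Sg : Sig} {c : TmConst} {A : Ty} {S : Srt} :
      SigWf Sg → Decl.tm c A ∈ Sg → Refines Sg [] S A →
      (∀ S', Decl.tmSrt c S' ∉ Sg) → SigWf (.tmSrt c S :: Sg)
  | sub {Sg : Sig} {s₁ s₂ : SrtConst} {a : TyConst} {L : Cls} :
      SigWf Sg → Decl.srt s₁ a L ∈ Sg → Decl.srt s₂ a L ∈ Sg →
      SigWf (.sub s₁ s₂ :: Sg)

end LFR

namespace LFR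

/-! ### Renaming -/

theorem upRen_comp (σ ρ : ℕ → ℕ) : upRen σ ∘ upRen ρ = upRen (σ ∘ ρ) := by
  funext i; cases i <;> rfl

mutual
theorem Atm.ren_ren (σ ρ : ℕ → ℕ) : ∀ R : Atm, (R.ren ρ).ren σ = R.ren (σ ∘ ρ)
  | .const c => rfl
  | .var i => rfl
  | .app R N => by simp only [Atm.ren, Atm.ren_ren σ ρ R, Nrm.ren_ren σ ρ N]
theorem Nrm.ren_ren (σ ρ : ℕ → ℕ) : ∀ N : Nrm, (N.ren ρ).ren σ = N.ren (σ ∘ ρ)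
  | .atm R => by simp only [Nrm.ren, Atm.ren_ren σ ρ R]
  | .lam N => by simp only [Nrm.ren, Nrm.ren_ren _ _ N, upRen_comp]
end

theorem ATy.ren_ren (σ ρ : ℕ → ℕ) (P : ATy) : (P.ren ρ).ren σ = P.ren (σ ∘ ρ) := by
  induction P with
  | const a => rfl
  | app P N ih => simp only [ATy.ren, ih, Nrm.ren_ren]

theorem Ty.ren_ren (σ ρ : ℕ → ℕ) (A : Ty) : (A.ren ρ).ren σ = A.ren (σ ∘ ρ) := by
  induction A generalizing σ ρ with
  | atm P => simp only [Ty.ren, ATy.ren_ren]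
  | pi A₁ A₂ ih₁ ih₂ => simp only [Ty.ren, ih₁, ih₂, upRen_comp]

theorem ASrt.ren_ren (σ ρ : ℕ → ℕ) (Q : ASrt) : (Q.ren ρ).ren σ = Q.ren (σ ∘ ρ) := by
  induction Q with
  | const s => rfl
  | app Q N ih => simp only [ASrt.ren, ih, Nrm.ren_ren]

theorem Srt.ren_ren (σ ρ : ℕ → ℕ) (S : Srt) : (S.ren ρ).ren σ = S.ren (σ ∘ ρ) := by
  induction S generalizing σ ρ with
  | atm Q => simp only [Srt.ren, ASrt.ren_ren]
  | pi S₁ A₁ S₂ ih₁ ih₂ => simp only [Srt.ren, ih₁, ih₂, Ty.ren_ren, upRen_comp]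
  | top => rfl
  | inter S₁ S₂ ih₁ ih₂ => simp only [Srt.ren, ih₁, ih₂]

theorem ATy.head_ren (ρ : ℕ → ℕ) (P : ATy) : (P.ren ρ).head = P.head := by
  induction P with
  | const a => rfl
  | app P N ih => exact ih

theorem Ty.simple_ren (ρ : ℕ → ℕ) (A : Ty) : (A.ren ρ).simple = A.simple := by
  induction A generalizing ρ with
  | atm P => simp only [Ty.ren, Ty.simple, ATy.head_ren]
  | pi A₁ A₂ ih₁ ih₂ => simp only [Ty.ren, Ty.simple, ih₁, ih₂]

theorem Nrm.shift_succ (n : ℕ) (N : Nrm) : N.shift (n + 1) = (N.shift n).shift 1 :=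
  (Nrm.ren_ren _ _ N).symm

theorem Ty.shift_succ (n : ℕ) (A : Ty) : A.shift (n + 1) = (A.shift n).shift 1 :=
  (Ty.ren_ren _ _ A).symm

theorem Srt.shift_succ (n : ℕ) (S : Srt) : S.shift (n + 1) = (S.shift n).shift 1 :=
  (Srt.ren_ren _ _ S).symm

theorem Nrm.shift_one_ren (ρ : ℕ → ℕ) (N : Nrm) :
    (N.shift 1).ren (upRen ρ) = (N.ren ρ).shift 1 :=
  (Nrm.ren_ren _ _ N).trans (Nrm.ren_ren (· + 1) ρ N).symm

theorem Ty.shift_one_ren (ρ : ℕ → ℕ) (A : Ty) :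
    (A.shift 1).ren (upRen ρ) = (A.ren ρ).shift 1 :=
  (Ty.ren_ren _ _ A).trans (Ty.ren_ren (· + 1) ρ A).symm

theorem Srt.shift_one_ren (ρ : ℕ → ℕ) (S : Srt) :
    (S.shift 1).ren (upRen ρ) = (S.ren ρ).shift 1 :=
  (Srt.ren_ren _ _ S).trans (Srt.ren_ren (· + 1) ρ S).symm

theorem upRen_id : upRen id = id := by
  funext i; cases i <;> rfl

mutual
theorem Atm.ren_id : ∀ R : Atm, R.ren id = R
  | .const c => rfl
  | .var i => rfl
  | .app R N => by simp only [Atm.ren, Atm.ren_id R, Nrm.ren_id N]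
theorem Nrm.ren_id : ∀ N : Nrm, N.ren id = N
  | .atm R => by simp only [Nrm.ren, Atm.ren_id R]
  | .lam N => by simp only [Nrm.ren, upRen_id, Nrm.ren_id N]
end

theorem ATy.ren_id (P : ATy) : P.ren id = P := by
  induction P with
  | const a => rfl
  | app P N ih => simp only [ATy.ren, ih, Nrm.ren_id]

theorem Ty.ren_id (A : Ty) : A.ren id = A := by
  induction A with
  | atm P => simp only [Ty.ren, ATy.ren_id]
  | pi A₁ A₂ ih₁ ih₂ => simp only [Ty.ren, upRen_id, ih₁, ih₂]

theorem ASrt.ren_id (Q : ASrt) : Q.ren id = Q := by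
  induction Q with
  | const s => rfl
  | app Q N ih => simp only [ASrt.ren, ih, Nrm.ren_id]

theorem Srt.ren_id (S : Srt) : S.ren id = S := by
  induction S with
  | atm Q => simp only [Srt.ren, ASrt.ren_id]
  | pi S₁ A₁ S₂ ih₁ ih₂ => simp only [Srt.ren, upRen_id, ih₁, ih₂, Ty.ren_id]
  | top => rfl
  | inter S₁ S₂ ih₁ ih₂ => simp only [Srt.ren, ih₁, ih₂]

theorem Nrm.shift_zero (N : Nrm) : N.shift 0 = N := Nrm.ren_id N

theorem Ty.shift_zero (A : Ty) : A.shift 0 = A := Ty.ren_id A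

theorem Srt.shift_zero (S : Srt) : S.shift 0 = S := Srt.ren_id S

/-! ### Renaming and hereditary substitution -/

/-- Substitution for the variable `k` turns the variable `i ≠ k` into the variable `i'`. -/
def VarSub (k i i' : ℕ) : Prop := (i < k ∧ i' = i) ∨ (k ≤ i' ∧ i = i' + 1)

theorem VarSub.hsubstRR {N₀ : Nrm} {k i i' : ℕ} {α : STy} (h : VarSub k i i') :
    HSubstRR N₀ k α (.var i) (.var i') := by
  rcases h with ⟨h, rfl⟩ | ⟨h, rfl⟩
  · exact .varLt h
  · exact .varGt h

theorem HSubstRR.varSub {N₀ : Nrm} {k i : ℕ} {α : STy} {R : Atm}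
    (h : HSubstRR N₀ k α (.var i) R) : ∃ i', R = .var i' ∧ VarSub k i i' := by
  cases h with
  | varLt h => exact ⟨i, rfl, .inl ⟨h, rfl⟩⟩
  | varGt h => exact ⟨_, rfl, .inr ⟨h, rfl⟩⟩

theorem VarSub.upRen {k k' : ℕ} {ρ ρ' : ℕ → ℕ}
    (h : ∀ i i', VarSub k i i' → VarSub k' (ρ i) (ρ' i')) (i i' : ℕ)
    (hi : VarSub (k + 1) i i') : VarSub (k' + 1) (LFR.upRen ρ i) (LFR.upRen ρ' i') := by
  rcases hi with ⟨hi, rfl⟩ | ⟨hi, rfl⟩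
  · cases i' with
    | zero => exact .inl ⟨by simp [LFR.upRen], rfl⟩
    | succ i =>
      have := h i i (.inl ⟨by omega, rfl⟩)
      simp only [VarSub, LFR.upRen] at this ⊢; omega
  · obtain ⟨j, rfl⟩ : ∃ j, i' = j + 1 := ⟨i' - 1, by omega⟩
    have := h (j + 1) j (.inr ⟨by omega, rfl⟩)
    simp only [VarSub, LFR.upRen] at this ⊢; omega

/-- The renamings `ρ` and `ρ'` carry the substitution `[N₀/k]` to the substitution `[N₀'/k']`. -/
structure RenSub (N₀ : Nrm) (k : ℕ) (N₀' : Nrm) (k' : ℕ) (ρ ρ' : ℕ → ℕ) : Prop where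
  target : ρ k = k'
  var : ∀ i i', VarSub k i i' → VarSub k' (ρ i) (ρ' i')
  term : (N₀.shift k).ren ρ' = N₀'.shift k'

theorem RenSub.up {N₀ N₀' : Nrm} {k k' : ℕ} {ρ ρ' : ℕ → ℕ} (h : RenSub N₀ k N₀' k' ρ ρ') :
    RenSub N₀ (k + 1) N₀' (k' + 1) (upRen ρ) (upRen ρ') where
  target := by simp [upRen, h.target]
  var := VarSub.upRen h.var
  term := by rw [Nrm.shift_succ, Nrm.shift_one_ren, h.term, ← Nrm.shift_succ]

theorem RenSub.upRen (N₀ : Nrm) (ρ : ℕ → ℕ) : RenSub N₀ 0 (N₀.ren ρ) 0 (LFR.upRen ρ) ρ where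
  target := rfl
  var i i' h := by
    rcases h with ⟨h, rfl⟩ | ⟨h, rfl⟩
    · omega
    · exact .inr ⟨by omega, rfl⟩
  term := by simp only [Nrm.shift_zero]

theorem RenSub.shift (N₀ : Nrm) (k n : ℕ) : RenSub N₀ k N₀ (k + n) (· + n) (· + n) where
  target := rfl
  var i i' h := by simp only [VarSub] at h ⊢; omega
  term := by
    simp only [Nrm.shift, Nrm.ren_ren]
    congr 1; funext i; simp [Nat.add_assoc]

mutual
theorem HSubstN.ren {N₀ N₀' N N' : Nrm} {k k' : ℕ} {α : STy} {ρ ρ' : ℕ → ℕ}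
    (hr : RenSub N₀ k N₀' k' ρ ρ') :
    HSubstN N₀ k α N N' → HSubstN N₀' k' α (N.ren ρ) (N'.ren ρ')
  | .atm h => .atm (h.ren hr)
  | .atmNorm h => .atmNorm (HSubstRN.ren hr h)
  | .lam h => .lam (h.ren hr.up)
theorem HSubstRR.ren {N₀ N₀' : Nrm} {R R' : Atm} {k k' : ℕ} {α : STy} {ρ ρ' : ℕ → ℕ}
    (hr : RenSub N₀ k N₀' k' ρ ρ') :
    HSubstRR N₀ k α R R' → HSubstRR N₀' k' α (R.ren ρ) (R'.ren ρ')
  | .varLt h => (hr.var _ _ (.inl ⟨h, rfl⟩)).hsubstRR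
  | .varGt h => (hr.var _ _ (.inr ⟨h, rfl⟩)).hsubstRR
  | .const => .const
  | .app h₁ h₂ => .app (h₁.ren hr) (h₂.ren hr)
theorem HSubstRN.ren {N₀ N₀' N' : Nrm} {R : Atm} {k k' : ℕ} {α β : STy} {ρ ρ' : ℕ → ℕ}
    (hr : RenSub N₀ k N₀' k' ρ ρ') :
    HSubstRN N₀ k α R N' β → HSubstRN N₀' k' α (R.ren ρ) (N'.ren ρ') β
  | .var => by
    rw [Atm.ren, hr.target, hr.term]; exact .var
  | .beta h₁ h₂ h₃ => .beta (h₁.ren hr) (h₂.ren hr) (h₃.ren (.upRen _ _))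
end

theorem HSubstP.ren {N₀ N₀' : Nrm} {k k' : ℕ} {α : STy} {ρ ρ' : ℕ → ℕ} {P P' : ATy}
    (hr : RenSub N₀ k N₀' k' ρ ρ') (h : HSubstP N₀ k α P P') :
    HSubstP N₀' k' α (P.ren ρ) (P'.ren ρ') := by
  induction h with
  | const => exact .const
  | app _ h ih => exact .app ih (h.ren hr)

theorem HSubstA.ren {N₀ N₀' : Nrm} {k k' : ℕ} {α : STy} {ρ ρ' : ℕ → ℕ} {A A' : Ty}
    (hr : RenSub N₀ k N₀' k' ρ ρ') (h : HSubstA N₀ k α A A') :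
    HSubstA N₀' k' α (A.ren ρ) (A'.ren ρ') := by
  induction h generalizing k' ρ ρ' with
  | atm h => exact .atm (h.ren hr)
  | pi _ _ ih₁ ih₂ => exact .pi (ih₁ hr) (ih₂ hr.up)

theorem HSubstQ.ren {N₀ N₀' : Nrm} {k k' : ℕ} {α : STy} {ρ ρ' : ℕ → ℕ} {Q Q' : ASrt}
    (hr : RenSub N₀ k N₀' k' ρ ρ') (h : HSubstQ N₀ k α Q Q') :
    HSubstQ N₀' k' α (Q.ren ρ) (Q'.ren ρ') := by
  induction h with
  | const => exact .const
  | app _ h ih => exact .app ih (h.ren hr)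

theorem HSubstS.ren {N₀ N₀' : Nrm} {k k' : ℕ} {α : STy} {ρ ρ' : ℕ → ℕ} {S S' : Srt}
    (hr : RenSub N₀ k N₀' k' ρ ρ') (h : HSubstS N₀ k α S S') :
    HSubstS N₀' k' α (S.ren ρ) (S'.ren ρ') := by
  induction h generalizing k' ρ ρ' with
  | atm h => exact .atm (h.ren hr)
  | pi _ h _ ih₁ ih₂ => exact .pi (ih₁ hr) (h.ren hr) (ih₂ hr.up)
  | top => exact .top
  | inter _ _ ih₁ ih₂ => exact .inter (ih₁ hr) (ih₂ hr)

/-! ### Substitution for a variable that does not occur -/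

theorem varSub_upRen {k : ℕ} {ρ ρ' : ℕ → ℕ} (h : ∀ i, VarSub k (ρ i) (ρ' i)) (i : ℕ) :
    VarSub (k + 1) (upRen ρ i) (upRen ρ' i) := by
  cases i with
  | zero => exact .inl ⟨by simp [upRen], rfl⟩
  | succ i => have := h i; simp only [VarSub, upRen] at this ⊢; omega

mutual
theorem HSubstRR.vacuous {N₀ : Nrm} {k : ℕ} {α : STy} {ρ ρ' : ℕ → ℕ}
    (h : ∀ i, VarSub k (ρ i) (ρ' i)) : ∀ R : Atm, HSubstRR N₀ k α (R.ren ρ) (R.ren ρ')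
  | .const _ => .const
  | .var i => (h i).hsubstRR
  | .app R N => .app (HSubstRR.vacuous h R) (HSubstN.vacuous h N)
theorem HSubstN.vacuous {N₀ : Nrm} {k : ℕ} {α : STy} {ρ ρ' : ℕ → ℕ}
    (h : ∀ i, VarSub k (ρ i) (ρ' i)) : ∀ N : Nrm, HSubstN N₀ k α (N.ren ρ) (N.ren ρ')
  | .atm R => .atm (HSubstRR.vacuous h R)
  | .lam N => .lam (HSubstN.vacuous (varSub_upRen h) N)
end

theorem HSubstP.vacuous {N₀ : Nrm} {k : ℕ} {α : STy} {ρ ρ' : ℕ → ℕ}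
    (h : ∀ i, VarSub k (ρ i) (ρ' i)) (P : ATy) : HSubstP N₀ k α (P.ren ρ) (P.ren ρ') := by
  induction P with
  | const a => exact .const
  | app P N ih => exact .app ih (.vacuous h N)

theorem HSubstA.vacuous {N₀ : Nrm} {k : ℕ} {α : STy} {ρ ρ' : ℕ → ℕ}
    (h : ∀ i, VarSub k (ρ i) (ρ' i)) (A : Ty) : HSubstA N₀ k α (A.ren ρ) (A.ren ρ') := by
  induction A generalizing k ρ ρ' with
  | atm P => exact .atm (.vacuous h P)
  | pi A₁ A₂ ih₁ ih₂ => exact .pi (ih₁ h) (ih₂ (varSub_upRen h))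

theorem HSubstQ.vacuous {N₀ : Nrm} {k : ℕ} {α : STy} {ρ ρ' : ℕ → ℕ}
    (h : ∀ i, VarSub k (ρ i) (ρ' i)) (Q : ASrt) : HSubstQ N₀ k α (Q.ren ρ) (Q.ren ρ') := by
  induction Q with
  | const s => exact .const
  | app Q N ih => exact .app ih (.vacuous h N)

theorem HSubstS.vacuous {N₀ : Nrm} {k : ℕ} {α : STy} {ρ ρ' : ℕ → ℕ}
    (h : ∀ i, VarSub k (ρ i) (ρ' i)) (S : Srt) : HSubstS N₀ k α (S.ren ρ) (S.ren ρ') := by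
  induction S generalizing k ρ ρ' with
  | atm Q => exact .atm (.vacuous h Q)
  | pi S₁ A₁ S₂ ih₁ ih₂ => exact .pi (ih₁ h) (.vacuous h A₁) (ih₂ (varSub_upRen h))
  | top => exact .top
  | inter S₁ S₂ ih₁ ih₂ => exact .inter (ih₁ h) (ih₂ h)

theorem varSub_shift {k n : ℕ} (h : k ≤ n) (i : ℕ) : VarSub k (i + (n + 1)) (i + n) :=
  .inr ⟨by omega, by omega⟩

/-! ### Determinism of hereditary substitution -/

theorem HSubstRR.not_hsubstRN {N₀ N : Nrm} {k : ℕ} {α β : STy} {R R' : Atm} :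
    HSubstRR N₀ k α R R' → HSubstRN N₀ k α R N β → False
  | .varLt h, h' => by cases h'; omega
  | .varGt h, h' => by cases h'; omega
  | .const, h' => by cases h'
  | .app h _, h' => by cases h' with | beta h' _ _ => exact h.not_hsubstRN h'

mutual
theorem HSubstN.unique {N₀ N N₁ N₂ : Nrm} {k : ℕ} {α : STy} :
    HSubstN N₀ k α N N₁ → HSubstN N₀ k α N N₂ → N₁ = N₂
  | .atm h, h' => by
    cases h' with
    | atm h' => rw [h.unique h']
    | atmNorm h' => exact (h.not_hsubstRN h').elim
  | .atmNorm h, h' => by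
    cases h' with
    | atm h' => exact (h'.not_hsubstRN h).elim
    | atmNorm h' => exact (HSubstRN.unique h h').1
  | .lam h, .lam h' => by rw [h.unique h']
theorem HSubstRR.unique {N₀ : Nrm} {R R₁ R₂ : Atm} {k : ℕ} {α : STy} :
    HSubstRR N₀ k α R R₁ → HSubstRR N₀ k α R R₂ → R₁ = R₂
  | .varLt h, h' => by
    cases h' with
    | varLt h' => rfl
    | varGt h' => omega
  | .varGt h, h' => by
    cases h' with
    | varLt h' => omega
    | varGt h' => rfl
  | .const, .const => rfl
  | .app h₁ h₂, .app h₁' h₂' => by rw [h₁.unique h₁', h₂.unique h₂']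
theorem HSubstRN.unique {N₀ N₁ N₂ : Nrm} {R : Atm} {k : ℕ} {α β₁ β₂ : STy} :
    HSubstRN N₀ k α R N₁ β₁ → HSubstRN N₀ k α R N₂ β₂ → N₁ = N₂ ∧ β₁ = β₂
  | .var, .var => ⟨rfl, rfl⟩
  | .beta h₁ h₂ h₃, .beta h₁' h₂' h₃' => by
    obtain ⟨h, h'⟩ := h₁.unique h₁'
    cases h; cases h'
    cases h₂.unique h₂'
    exact ⟨h₃.unique h₃', rfl⟩
end

theorem HSubstP.unique {N₀ : Nrm} {k : ℕ} {α : STy} {P P₁ P₂ : ATy}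
    (h : HSubstP N₀ k α P P₁) (h' : HSubstP N₀ k α P P₂) : P₁ = P₂ := by
  induction h generalizing P₂ with
  | const => cases h'; rfl
  | app _ h ih => cases h' with | app h₁ h₂ => rw [ih h₁, h.unique h₂]

theorem HSubstA.unique {N₀ : Nrm} {k : ℕ} {α : STy} {A A₁ A₂ : Ty}
    (h : HSubstA N₀ k α A A₁) (h' : HSubstA N₀ k α A A₂) : A₁ = A₂ := by
  induction h generalizing A₂ with
  | atm h => cases h' with | atm h' => rw [h.unique h']
  | pi _ _ ih₁ ih₂ => cases h' with | pi h₁ h₂ => rw [ih₁ h₁, ih₂ h₂]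

theorem HSubstK.unique {N₀ : Nrm} {k : ℕ} {α : STy} {K K₁ K₂ : Kind}
    (h : HSubstK N₀ k α K K₁) (h' : HSubstK N₀ k α K K₂) : K₁ = K₂ := by
  induction h generalizing K₂ with
  | type => cases h'; rfl
  | pi h _ ih => cases h' with | pi h₁ h₂ => rw [h.unique h₁, ih h₂]

theorem HSubstQ.unique {N₀ : Nrm} {k : ℕ} {α : STy} {Q Q₁ Q₂ : ASrt}
    (h : HSubstQ N₀ k α Q Q₁) (h' : HSubstQ N₀ k α Q Q₂) : Q₁ = Q₂ := by
  induction h generalizing Q₂ with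
  | const => cases h'; rfl
  | app _ h ih => cases h' with | app h₁ h₂ => rw [ih h₁, h.unique h₂]

theorem HSubstS.unique {N₀ : Nrm} {k : ℕ} {α : STy} {S S₁ S₂ : Srt}
    (h : HSubstS N₀ k α S S₁) (h' : HSubstS N₀ k α S S₂) : S₁ = S₂ := by
  induction h generalizing S₂ with
  | atm h => cases h' with | atm h' => rw [h.unique h']
  | pi _ h _ ih₁ ih₂ => cases h' with | pi h₁ h₂ h₃ => rw [ih₁ h₁, h.unique h₂, ih₂ h₃]
  | top => cases h'; rfl
  | inter _ _ ih₁ ih₂ => cases h' with | inter h₁ h₂ => rw [ih₁ h₁, ih₂ h₂]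

theorem HSubstL.unique {N₀ : Nrm} {k : ℕ} {α : STy} {L L₁ L₂ : Cls}
    (h : HSubstL N₀ k α L L₁) (h' : HSubstL N₀ k α L L₂) : L₁ = L₂ := by
  induction h generalizing L₂ with
  | sort => cases h'; rfl
  | pi hS hA _ ih => cases h' with | pi h₁ h₂ h₃ => rw [hS.unique h₁, hA.unique h₂, ih h₃]
  | top => cases h'; rfl
  | inter _ _ ih₁ ih₂ => cases h' with | inter h₁ h₂ => rw [ih₁ h₁, ih₂ h₂]

/-! ### Composition of hereditary substitutions -/

theorem HSubstRN.sizeOf_le {N₀ N : Nrm} {k : ℕ} {α β : STy} {R : Atm}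
    (h : HSubstRN N₀ k α R N β) : sizeOf β ≤ sizeOf α :=
  match h with
  | .var => le_rfl
  | .beta h _ _ => by
    have := h.sizeOf_le
    simp only [STy.arrow.sizeOf_spec] at this
    omega

/-- The outer substitution `[N₀/x₀]` at type `α₀` commutes with the inner substitution `[N₂/x₂]`
at type `α₂`. -/
def Commute (α₀ α₂ : STy) : Prop :=
  ∀ ⦃N₀ N₂ N₂' N N' N'' : Nrm⦄ ⦃j m : ℕ⦄,
    HSubstN N₀ m α₀ N₂ N₂' → HSubstN N₂ j α₂ N N' → HSubstN N₀ (j + m + 1) α₀ N N'' →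
    ∃ M, HSubstN N₀ (j + m) α₀ N' M ∧ HSubstN N₂' j α₂ N'' M

theorem VarSub.comp {j m i i' i'' : ℕ} (h : VarSub j i i') (h' : VarSub (j + m + 1) i i'') :
    ∃ l, VarSub (j + m) i' l ∧ VarSub j i'' l := by
  by_cases hi : i' < j + m
  · exact ⟨i', by unfold VarSub at *; omega, by unfold VarSub at *; omega⟩
  · exact ⟨i' - 1, by unfold VarSub at *; omega, by unfold VarSub at *; omega⟩

theorem HSubstRR.comp_var {N₀ N₂ N₂' : Nrm} {R' R'' : Atm} {j m i : ℕ} {α₀ α₂ : STy}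
    (h : HSubstRR N₂ j α₂ (.var i) R') (h' : HSubstRR N₀ (j + m + 1) α₀ (.var i) R'') :
    ∃ M, HSubstRR N₀ (j + m) α₀ R' M ∧ HSubstRR N₂' j α₂ R'' M := by
  obtain ⟨i', rfl, hi⟩ := h.varSub
  obtain ⟨i'', rfl, hi'⟩ := h'.varSub
  obtain ⟨l, hl, hl'⟩ := hi.comp hi'
  exact ⟨.var l, hl.hsubstRR, hl'.hsubstRR⟩

/-- The three ways in which two substitutions for different variables act on an atomic term. -/
def CommuteAtm (α₀ α₂ : STy) (N₀ N₂ N₂' : Nrm) (j m : ℕ) (R : Atm) : Prop :=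
  (∀ ⦃R' R''⦄, HSubstRR N₂ j α₂ R R' → HSubstRR N₀ (j + m + 1) α₀ R R'' →
    ∃ M, HSubstRR N₀ (j + m) α₀ R' M ∧ HSubstRR N₂' j α₂ R'' M) ∧
  (∀ ⦃N' β R''⦄, HSubstRN N₂ j α₂ R N' β → HSubstRR N₀ (j + m + 1) α₀ R R'' →
    ∃ M, HSubstN N₀ (j + m) α₀ N' M ∧ HSubstRN N₂' j α₂ R'' M β) ∧
  (∀ ⦃R' N'' β⦄, HSubstRR N₂ j α₂ R R' → HSubstRN N₀ (j + m + 1) α₀ R N'' β →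
    ∃ M, HSubstRN N₀ (j + m) α₀ R' M β ∧ HSubstN N₂' j α₂ N'' M) ∧
  (∀ ⦃N' N'' β β'⦄, HSubstRN N₂ j α₂ R N' β → HSubstRN N₀ (j + m + 1) α₀ R N'' β' → False)

mutual
theorem commute_nrm {α₀ α₂ : STy}
    (ih : ∀ β₀ β₂ : STy, sizeOf β₀ + sizeOf β₂ < sizeOf α₀ + sizeOf α₂ → Commute β₀ β₂)
    {N₀ N₂ N₂' : Nrm} {j m : ℕ} (h₂ : HSubstN N₀ m α₀ N₂ N₂') : ∀ (N : Nrm) {N' N'' : Nrm},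
    HSubstN N₂ j α₂ N N' → HSubstN N₀ (j + m + 1) α₀ N N'' →
    ∃ M, HSubstN N₀ (j + m) α₀ N' M ∧ HSubstN N₂' j α₂ N'' M
  | .atm R, N', N'', h, h' => by
    obtain ⟨c₁, c₂, c₃, c₄⟩ := commute_atm ih (j := j) h₂ R
    cases h with
    | atm h => cases h' with
      | atm h' =>
        obtain ⟨M, hM, hM'⟩ := c₁ h h'
        exact ⟨_, .atm hM, .atm hM'⟩
      | atmNorm h' =>
        obtain ⟨M, hM, hM'⟩ := c₃ h h'
        cases hM' with
        | atm hM' => exact ⟨_, .atmNorm hM, .atm hM'⟩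
        | atmNorm hM' => exact ⟨_, .atmNorm hM, .atmNorm hM'⟩
    | atmNorm h => cases h' with
      | atm h' =>
        obtain ⟨M, hM, hM'⟩ := c₂ h h'
        cases hM with
        | atm hM => exact ⟨_, .atm hM, .atmNorm hM'⟩
        | atmNorm hM => exact ⟨_, .atmNorm hM, .atmNorm hM'⟩
      | atmNorm h' => exact (c₄ h h').elim
  | .lam N, N', N'', h, h' => by
    cases h with | lam h => cases h' with | lam h' =>
    rw [show j + m + 1 + 1 = (j + 1) + m + 1 by omega] at h'
    obtain ⟨M, hM, hM'⟩ := commute_nrm ih h₂ N h h'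
    exact ⟨_, .lam (by rwa [show j + m + 1 = (j + 1) + m by omega]), .lam hM'⟩
theorem commute_atm {α₀ α₂ : STy}
    (ih : ∀ β₀ β₂ : STy, sizeOf β₀ + sizeOf β₂ < sizeOf α₀ + sizeOf α₂ → Commute β₀ β₂)
    {N₀ N₂ N₂' : Nrm} {j m : ℕ} (h₂ : HSubstN N₀ m α₀ N₂ N₂') :
    ∀ R : Atm, CommuteAtm α₀ α₂ N₀ N₂ N₂' j m R
  | .const c => by
    refine ⟨?_, ?_, ?_, ?_⟩
    · rintro _ _ ⟨⟩ ⟨⟩; exact ⟨_, .const, .const⟩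
    · rintro _ _ _ ⟨⟩
    · rintro _ _ _ _ ⟨⟩
    · rintro _ _ _ _ ⟨⟩
  | .var i => by
    refine ⟨fun _ _ => HSubstRR.comp_var, ?_, ?_, ?_⟩
    · rintro _ _ _ ⟨⟩ h'
      obtain ⟨i'', rfl, hi⟩ := h'.varSub
      obtain rfl : i'' = j := by unfold VarSub at hi; omega
      refine ⟨_, ?_, .var⟩
      have := h₂.ren (RenSub.shift N₀ m i'')
      rwa [Nat.add_comm] at this
    · rintro _ _ _ h ⟨⟩
      obtain ⟨i', rfl, hi⟩ := h.varSub
      obtain rfl : i' = j + m := by unfold VarSub at hi; omega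
      exact ⟨_, .var, .vacuous (varSub_shift (by omega)) N₀⟩
    · rintro _ _ _ _ ⟨⟩ h'
      generalize hi : j + m + 1 = i at h'
      cases h'; omega
  | .app R N => by
    obtain ⟨c₁, c₂, c₃, c₄⟩ := commute_atm ih (j := j) h₂ R
    refine ⟨?_, ?_, ?_, ?_⟩
    · rintro _ _ (_ | _ | _ | ⟨hR, hN⟩) (_ | _ | _ | ⟨hR', hN'⟩)
      obtain ⟨M, hM, hM'⟩ := c₁ hR hR'
      obtain ⟨M₂, hM₂, hM₂'⟩ := commute_nrm ih h₂ N hN hN'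
      exact ⟨_, .app hM hM₂, .app hM' hM₂'⟩
    · rintro _ _ _ (_ | ⟨hR, hN, hb⟩) (_ | _ | _ | ⟨hR', hN'⟩)
      obtain ⟨M, ⟨⟩ | ⟨⟩ | ⟨hM⟩, hM'⟩ := c₂ hR hR'
      obtain ⟨M₂, hM₂, hM₂'⟩ := commute_nrm ih h₂ N hN hN'
      have hs := hR.sizeOf_le
      simp only [STy.arrow.sizeOf_spec] at hs
      obtain ⟨M₃, hM₃, hM₃'⟩ := ih _ _ (by omega) hM₂ hb (by rwa [Nat.zero_add])
      exact ⟨M₃, by rwa [Nat.zero_add] at hM₃, .beta hM' hM₂' hM₃'⟩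
    · rintro _ _ _ (_ | _ | _ | ⟨hR, hN⟩) (_ | ⟨hR', hN', hb⟩)
      obtain ⟨M, hM, ⟨⟩ | ⟨⟩ | ⟨hM'⟩⟩ := c₃ hR hR'
      obtain ⟨M₂, hM₂, hM₂'⟩ := commute_nrm ih h₂ N hN hN'
      have hs := hR'.sizeOf_le
      simp only [STy.arrow.sizeOf_spec] at hs
      obtain ⟨M₃, hM₃, hM₃'⟩ := ih _ _ (by omega) hM₂' hb (by rwa [Nat.zero_add])
      exact ⟨M₃, .beta hM hM₂ hM₃', by rwa [Nat.zero_add] at hM₃⟩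
    · rintro _ _ _ _ (_ | ⟨hR, _, _⟩) (_ | ⟨hR', _, _⟩)
      exact c₄ hR hR'
end

theorem commute (α₀ α₂ : STy) : Commute α₀ α₂ := by
  induction hn : sizeOf α₀ + sizeOf α₂ using Nat.strong_induction_on generalizing α₀ α₂ with
  | _ n ih =>
    intro N₀ N₂ N₂' N N' N'' j m h₂ h h'
    exact commute_nrm (fun β₀ β₂ hβ => ih _ (hn ▸ hβ) β₀ β₂ rfl) h₂ N h h'

theorem HSubstN.comp {N₀ N₂ N₂' N N' N'' : Nrm} {α₀ α₂ : STy} {j m : ℕ}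
    (h₂ : HSubstN N₀ m α₀ N₂ N₂') (h : HSubstN N₂ j α₂ N N')
    (h' : HSubstN N₀ (j + m + 1) α₀ N N'') :
    ∃ M, HSubstN N₀ (j + m) α₀ N' M ∧ HSubstN N₂' j α₂ N'' M :=
  commute α₀ α₂ h₂ h h'

theorem HSubstP.comp {N₀ N₂ N₂' : Nrm} {P P' P'' : ATy} {α₀ α₂ : STy} {j m : ℕ}
    (h₂ : HSubstN N₀ m α₀ N₂ N₂') (h : HSubstP N₂ j α₂ P P')
    (h' : HSubstP N₀ (j + m + 1) α₀ P P'') :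
    ∃ M, HSubstP N₀ (j + m) α₀ P' M ∧ HSubstP N₂' j α₂ P'' M := by
  induction P generalizing P' P'' with
  | const a => cases h; cases h'; exact ⟨_, .const, .const⟩
  | app P N ih =>
    cases h with | app hP hN => cases h' with | app hP' hN' =>
    obtain ⟨_, hM, hM'⟩ := ih hP hP'
    obtain ⟨_, hM₂, hM₂'⟩ := h₂.comp hN hN'
    exact ⟨_, .app hM hM₂, .app hM' hM₂'⟩

theorem HSubstA.comp {N₀ N₂ N₂' : Nrm} {A A' A'' : Ty} {α₀ α₂ : STy} {j m : ℕ}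
    (h₂ : HSubstN N₀ m α₀ N₂ N₂') (h : HSubstA N₂ j α₂ A A')
    (h' : HSubstA N₀ (j + m + 1) α₀ A A'') :
    ∃ M, HSubstA N₀ (j + m) α₀ A' M ∧ HSubstA N₂' j α₂ A'' M := by
  induction A generalizing A' A'' j with
  | atm P =>
    cases h with | atm h => cases h' with | atm h' =>
    obtain ⟨_, hM, hM'⟩ := h.comp h₂ h'
    exact ⟨_, .atm hM, .atm hM'⟩
  | pi A₁ A₂ ih₁ ih₂ =>
    cases h with | pi hA hB => cases h' with | pi hA' hB' =>
    rw [show j + m + 1 + 1 = (j + 1) + m + 1 by omega] at hB'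
    obtain ⟨_, hM, hM'⟩ := ih₁ hA hA'
    obtain ⟨_, hM₂, hM₂'⟩ := ih₂ hB hB'
    rw [show j + 1 + m = j + m + 1 by omega] at hM₂
    exact ⟨_, .pi hM hM₂, .pi hM' hM₂'⟩

theorem HSubstK.comp {N₀ N₂ N₂' : Nrm} {K K' K'' : Kind} {α₀ α₂ : STy} {j m : ℕ}
    (h₂ : HSubstN N₀ m α₀ N₂ N₂') (h : HSubstK N₂ j α₂ K K')
    (h' : HSubstK N₀ (j + m + 1) α₀ K K'') :
    ∃ M, HSubstK N₀ (j + m) α₀ K' M ∧ HSubstK N₂' j α₂ K'' M := by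
  induction K generalizing K' K'' j with
  | type => cases h; cases h'; exact ⟨_, .type, .type⟩
  | pi A K ih =>
    cases h with | pi hA hK => cases h' with | pi hA' hK' =>
    rw [show j + m + 1 + 1 = (j + 1) + m + 1 by omega] at hK'
    obtain ⟨_, hM, hM'⟩ := hA.comp h₂ hA'
    obtain ⟨_, hM₂, hM₂'⟩ := ih hK hK'
    rw [show j + 1 + m = j + m + 1 by omega] at hM₂
    exact ⟨_, .pi hM hM₂, .pi hM' hM₂'⟩

theorem HSubstQ.comp {N₀ N₂ N₂' : Nrm} {Q Q' Q'' : ASrt} {α₀ α₂ : STy} {j m : ℕ}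
    (h₂ : HSubstN N₀ m α₀ N₂ N₂') (h : HSubstQ N₂ j α₂ Q Q')
    (h' : HSubstQ N₀ (j + m + 1) α₀ Q Q'') :
    ∃ M, HSubstQ N₀ (j + m) α₀ Q' M ∧ HSubstQ N₂' j α₂ Q'' M := by
  induction Q generalizing Q' Q'' with
  | const s => cases h; cases h'; exact ⟨_, .const, .const⟩
  | app Q N ih =>
    cases h with | app hQ hN => cases h' with | app hQ' hN' =>
    obtain ⟨_, hM, hM'⟩ := ih hQ hQ'
    obtain ⟨_, hM₂, hM₂'⟩ := h₂.comp hN hN'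
    exact ⟨_, .app hM hM₂, .app hM' hM₂'⟩

theorem HSubstS.comp {N₀ N₂ N₂' : Nrm} {S S' S'' : Srt} {α₀ α₂ : STy} {j m : ℕ}
    (h₂ : HSubstN N₀ m α₀ N₂ N₂') (h : HSubstS N₂ j α₂ S S')
    (h' : HSubstS N₀ (j + m + 1) α₀ S S'') :
    ∃ M, HSubstS N₀ (j + m) α₀ S' M ∧ HSubstS N₂' j α₂ S'' M := by
  induction S generalizing S' S'' j with
  | atm Q =>
    cases h with | atm h => cases h' with | atm h' =>
    obtain ⟨_, hM, hM'⟩ := h.comp h₂ h'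
    exact ⟨_, .atm hM, .atm hM'⟩
  | pi S₁ A₁ S₂ ih₁ ih₂ =>
    cases h with | pi hS hA hB => cases h' with | pi hS' hA' hB' =>
    rw [show j + m + 1 + 1 = (j + 1) + m + 1 by omega] at hB'
    obtain ⟨_, hM, hM'⟩ := ih₁ hS hS'
    obtain ⟨_, hM₁, hM₁'⟩ := hA.comp h₂ hA'
    obtain ⟨_, hM₂, hM₂'⟩ := ih₂ hB hB'
    rw [show j + 1 + m = j + m + 1 by omega] at hM₂
    exact ⟨_, .pi hM hM₁ hM₂, .pi hM' hM₁' hM₂'⟩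
  | top => cases h; cases h'; exact ⟨_, .top, .top⟩
  | inter S₁ S₂ ih₁ ih₂ =>
    cases h with | inter hS hT => cases h' with | inter hS' hT' =>
    obtain ⟨_, hM, hM'⟩ := ih₁ hS hS'
    obtain ⟨_, hM₂, hM₂'⟩ := ih₂ hT hT'
    exact ⟨_, .inter hM hM₂, .inter hM' hM₂'⟩

theorem HSubstL.comp {N₀ N₂ N₂' : Nrm} {L L' L'' : Cls} {α₀ α₂ : STy} {j m : ℕ}
    (h₂ : HSubstN N₀ m α₀ N₂ N₂') (h : HSubstL N₂ j α₂ L L')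
    (h' : HSubstL N₀ (j + m + 1) α₀ L L'') :
    ∃ M, HSubstL N₀ (j + m) α₀ L' M ∧ HSubstL N₂' j α₂ L'' M := by
  induction L generalizing L' L'' j with
  | sort => cases h; cases h'; exact ⟨_, .sort, .sort⟩
  | pi S A L ih =>
    cases h with | pi hS hA hL => cases h' with | pi hS' hA' hL' =>
    rw [show j + m + 1 + 1 = (j + 1) + m + 1 by omega] at hL'
    obtain ⟨_, hM, hM'⟩ := hS.comp h₂ hS'
    obtain ⟨_, hM₁, hM₁'⟩ := hA.comp h₂ hA'
    obtain ⟨_, hM₂, hM₂'⟩ := ih hL hL'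
    rw [show j + 1 + m = j + m + 1 by omega] at hM₂
    exact ⟨_, .pi hM hM₁ hM₂, .pi hM' hM₁' hM₂'⟩
  | top => cases h; cases h'; exact ⟨_, .top, .top⟩
  | inter L₁ L₂ ih₁ ih₂ =>
    cases h with | inter hS hT => cases h' with | inter hS' hT' =>
    obtain ⟨_, hM, hM'⟩ := ih₁ hS hS'
    obtain ⟨_, hM₂, hM₂'⟩ := ih₂ hT hT'
    exact ⟨_, .inter hM hM₂, .inter hM' hM₂'⟩

/-! ### Hereditary substitution and simple types -/

theorem HSubstP.head_eq {N₀ : Nrm} {k : ℕ} {α : STy} {P P' : ATy} (h : HSubstP N₀ k α P P') :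
    P'.head = P.head := by
  induction h with
  | const => rfl
  | app _ _ ih => exact ih

theorem HSubstA.simple_eq {N₀ : Nrm} {k : ℕ} {α : STy} {A A' : Ty} (h : HSubstA N₀ k α A A') :
    A'.simple = A.simple := by
  induction h with
  | atm h => rw [Ty.simple, h.head_eq, Ty.simple]
  | pi _ _ ih₁ ih₂ => rw [Ty.simple, ih₁, ih₂, Ty.simple]

/-! ### Simple typing

Every judgment of LF and LFR is shadowed by a judgment that only looks at simple types.  It is
enough for hereditary substitution to be defined, and it is stable under hereditary substitution
without any appeal to the dependent judgments. -/

/-- The simple types of the arguments of a type family of kind `K`. -/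
def Kind.simple : Kind → List STy
  | .type => []
  | .pi A K => A.simple :: K.simple

mutual
  /-- The atomic term `R` has the simple type `α`. -/
  inductive AtmHasSTy (Sg : Sig) : List STy → Atm → STy → Prop where
    | const {Γ : List STy} {c : TmConst} {A : Ty} :
        Decl.tm c A ∈ Sg → AtmHasSTy Sg Γ (.const c) A.simple
    | var {Γ : List STy} {i : ℕ} {α : STy} : Γ[i]? = some α → AtmHasSTy Sg Γ (.var i) α
    | app {Γ : List STy} {R : Atm} {N : Nrm} {α β : STy} :
        AtmHasSTy Sg Γ R (.arrow α β) → NrmHasSTy Sg Γ N α → AtmHasSTy Sg Γ (.app R N) β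
  /-- The normal term `N` has the simple type `α`. -/
  inductive NrmHasSTy (Sg : Sig) : List STy → Nrm → STy → Prop where
    | atm {Γ : List STy} {R : Atm} {a : TyConst} :
        AtmHasSTy Sg Γ R (.base a) → NrmHasSTy Sg Γ (.atm R) (.base a)
    | lam {Γ : List STy} {N : Nrm} {α β : STy} :
        NrmHasSTy Sg (α :: Γ) N β → NrmHasSTy Sg Γ (.lam N) (.arrow α β)
end

/-- The atomic type family `P` takes further arguments of the simple types `l`. -/
inductive ATyHasSKind (Sg : Sig) (Γ : List STy) : ATy → List STy → Prop where
  | const {a : TyConst} {K : Kind} : Decl.ty a K ∈ Sg → ATyHasSKind Sg Γ (.const a) K.simple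
  | app {P : ATy} {N : Nrm} {α : STy} {l : List STy} :
      ATyHasSKind Sg Γ P (α :: l) → NrmHasSTy Sg Γ N α → ATyHasSKind Sg Γ (.app P N) l

/-- The type `A` is well-formed with respect to simple types. -/
inductive TySWf (Sg : Sig) : List STy → Ty → Prop where
  | atm {Γ : List STy} {P : ATy} : ATyHasSKind Sg Γ P [] → TySWf Sg Γ (.atm P)
  | pi {Γ : List STy} {A B : Ty} :
      TySWf Sg Γ A → TySWf Sg (A.simple :: Γ) B → TySWf Sg Γ (.pi A B)

/-- The kind `K` is well-formed with respect to simple types. -/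
inductive KindSWf (Sg : Sig) : List STy → Kind → Prop where
  | type {Γ : List STy} : KindSWf Sg Γ .type
  | pi {Γ : List STy} {A : Ty} {K : Kind} :
      TySWf Sg Γ A → KindSWf Sg (A.simple :: Γ) K → KindSWf Sg Γ (.pi A K)

/-- The atomic sort family `Q` refines a type family with head `a` that takes further arguments of
the simple types `l`. -/
inductive ASrtHasSKind (Sg : Sig) (Γ : List STy) : ASrt → TyConst → List STy → Prop where
  | const {s : SrtConst} {a : TyConst} {L : Cls} {K : Kind} :
      Decl.srt s a L ∈ Sg → Decl.ty a K ∈ Sg → ASrtHasSKind Sg Γ (.const s) a K.simple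
  | app {Q : ASrt} {N : Nrm} {a : TyConst} {α : STy} {l : List STy} :
      ASrtHasSKind Sg Γ Q a (α :: l) → NrmHasSTy Sg Γ N α → ASrtHasSKind Sg Γ (.app Q N) a l

/-- The sort `S` refines the simple type `α`. -/
inductive SrtSRefines (Sg : Sig) : List STy → Srt → STy → Prop where
  | atm {Γ : List STy} {Q : ASrt} {a : TyConst} :
      ASrtHasSKind Sg Γ Q a [] → SrtSRefines Sg Γ (.atm Q) (.base a)
  | pi {Γ : List STy} {S T : Srt} {A : Ty} {β : STy} :
      SrtSRefines Sg Γ S A.simple → TySWf Sg Γ A → SrtSRefines Sg (A.simple :: Γ) T β →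
      SrtSRefines Sg Γ (.pi S A T) (.arrow A.simple β)
  | top {Γ : List STy} {α : STy} : SrtSRefines Sg Γ .top α
  | inter {Γ : List STy} {S₁ S₂ : Srt} {α : STy} :
      SrtSRefines Sg Γ S₁ α → SrtSRefines Sg Γ S₂ α → SrtSRefines Sg Γ (.inter S₁ S₂) α

/-- The class `L` refines a kind whose arguments have the simple types `l`. -/
inductive ClsSRefines (Sg : Sig) : List STy → Cls → List STy → Prop where
  | sort {Γ : List STy} : ClsSRefines Sg Γ .sort []
  | pi {Γ : List STy} {S : Srt} {A : Ty} {L : Cls} {l : List STy} :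
      SrtSRefines Sg Γ S A.simple → TySWf Sg Γ A → ClsSRefines Sg (A.simple :: Γ) L l →
      ClsSRefines Sg Γ (.pi S A L) (A.simple :: l)
  | top {Γ : List STy} {l : List STy} : ClsSRefines Sg Γ .top l
  | inter {Γ : List STy} {L₁ L₂ : Cls} {l : List STy} :
      ClsSRefines Sg Γ L₁ l → ClsSRefines Sg Γ L₂ l → ClsSRefines Sg Γ (.inter L₁ L₂) l

/-! ### Monotonicity in the signature -/

mutual
theorem AtmHasSTy.mono {Sg Sg' : Sig} (hs : Sg ⊆ Sg') {Γ : List STy} {R : Atm} {α : STy} :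
    AtmHasSTy Sg Γ R α → AtmHasSTy Sg' Γ R α
  | .const h => .const (hs h)
  | .var h => .var h
  | .app h₁ h₂ => .app (h₁.mono hs) (h₂.mono hs)
theorem NrmHasSTy.mono {Sg Sg' : Sig} (hs : Sg ⊆ Sg') {Γ : List STy} {N : Nrm} {α : STy} :
    NrmHasSTy Sg Γ N α → NrmHasSTy Sg' Γ N α
  | .atm h => .atm (h.mono hs)
  | .lam h => .lam (h.mono hs)
end

theorem ATyHasSKind.mono {Sg Sg' : Sig} (hs : Sg ⊆ Sg') {Γ : List STy} {P : ATy} {l : List STy}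
    (h : ATyHasSKind Sg Γ P l) : ATyHasSKind Sg' Γ P l := by
  induction h with
  | const h => exact .const (hs h)
  | app _ h ih => exact .app ih (h.mono hs)

theorem TySWf.mono {Sg Sg' : Sig} (hs : Sg ⊆ Sg') {Γ : List STy} {A : Ty} (h : TySWf Sg Γ A) :
    TySWf Sg' Γ A := by
  induction h with
  | atm h => exact .atm (h.mono hs)
  | pi _ _ ih₁ ih₂ => exact .pi ih₁ ih₂

theorem KindSWf.mono {Sg Sg' : Sig} (hs : Sg ⊆ Sg') {Γ : List STy} {K : Kind}
    (h : KindSWf Sg Γ K) : KindSWf Sg' Γ K := by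
  induction h with
  | type => exact .type
  | pi h _ ih => exact .pi (h.mono hs) ih

theorem ASrtHasSKind.mono {Sg Sg' : Sig} (hs : Sg ⊆ Sg') {Γ : List STy} {Q : ASrt} {a : TyConst}
    {l : List STy} (h : ASrtHasSKind Sg Γ Q a l) : ASrtHasSKind Sg' Γ Q a l := by
  induction h with
  | const h h' => exact .const (hs h) (hs h')
  | app _ h ih => exact .app ih (h.mono hs)

theorem SrtSRefines.mono {Sg Sg' : Sig} (hs : Sg ⊆ Sg') {Γ : List STy} {S : Srt} {α : STy}
    (h : SrtSRefines Sg Γ S α) : SrtSRefines Sg' Γ S α := by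
  induction h with
  | atm h => exact .atm (h.mono hs)
  | pi _ h _ ih₁ ih₂ => exact .pi ih₁ (h.mono hs) ih₂
  | top => exact .top
  | inter _ _ ih₁ ih₂ => exact .inter ih₁ ih₂

theorem ClsSRefines.mono {Sg Sg' : Sig} (hs : Sg ⊆ Sg') {Γ : List STy} {L : Cls} {l : List STy}
    (h : ClsSRefines Sg Γ L l) : ClsSRefines Sg' Γ L l := by
  induction h with
  | sort => exact .sort
  | pi h₁ h₂ _ ih => exact .pi (h₁.mono hs) (h₂.mono hs) ih
  | top => exact .top
  | inter _ _ ih₁ ih₂ => exact .inter ih₁ ih₂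

/-! ### Renaming for simple typing -/

/-- The renaming `ρ` maps the variables of `Γ` to variables of `Δ` of the same simple type. -/
def SRen (ρ : ℕ → ℕ) (Γ Δ : List STy) : Prop :=
  ∀ ⦃i α⦄, Γ[i]? = some α → Δ[ρ i]? = some α

theorem SRen.up {ρ : ℕ → ℕ} {Γ Δ : List STy} (h : SRen ρ Γ Δ) (α : STy) :
    SRen (upRen ρ) (α :: Γ) (α :: Δ) := by
  intro i β hi
  cases i with
  | zero => exact hi
  | succ i => exact h hi

theorem SRen.succ (α : STy) (Γ : List STy) : SRen (· + 1) Γ (α :: Γ) := fun _ _ h => h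

theorem SRen.append (Γ Δ : List STy) : SRen id Γ (Γ ++ Δ) := by
  intro i α h
  have hi : i < Γ.length := (List.getElem?_eq_some_iff.1 h).1
  rw [id, List.getElem?_append_left hi, h]

mutual
theorem AtmHasSTy.ren {Sg : Sig} {ρ : ℕ → ℕ} {Γ Δ : List STy} (hr : SRen ρ Γ Δ) {R : Atm}
    {α : STy} : AtmHasSTy Sg Γ R α → AtmHasSTy Sg Δ (R.ren ρ) α
  | .const h => .const h
  | .var h => .var (hr h)
  | .app h₁ h₂ => .app (h₁.ren hr) (h₂.ren hr)
theorem NrmHasSTy.ren {Sg : Sig} {ρ : ℕ → ℕ} {Γ Δ : List STy} (hr : SRen ρ Γ Δ) {N : Nrm}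
    {α : STy} : NrmHasSTy Sg Γ N α → NrmHasSTy Sg Δ (N.ren ρ) α
  | .atm h => .atm (h.ren hr)
  | .lam h => .lam (h.ren (hr.up _))
end

theorem ATyHasSKind.ren {Sg : Sig} {ρ : ℕ → ℕ} {Γ Δ : List STy} (hr : SRen ρ Γ Δ) {P : ATy}
    {l : List STy} (h : ATyHasSKind Sg Γ P l) : ATyHasSKind Sg Δ (P.ren ρ) l := by
  induction h with
  | const h => exact .const h
  | app _ h ih => exact .app ih (h.ren hr)

theorem TySWf.ren {Sg : Sig} {ρ : ℕ → ℕ} {Γ Δ : List STy} (hr : SRen ρ Γ Δ) {A : Ty}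
    (h : TySWf Sg Γ A) : TySWf Sg Δ (A.ren ρ) := by
  induction h generalizing ρ Δ with
  | atm h => exact .atm (h.ren hr)
  | pi _ _ ih₁ ih₂ => exact .pi (ih₁ hr) (ih₂ (by rw [Ty.simple_ren]; exact hr.up _))

theorem ASrtHasSKind.ren {Sg : Sig} {ρ : ℕ → ℕ} {Γ Δ : List STy} (hr : SRen ρ Γ Δ) {Q : ASrt}
    {a : TyConst} {l : List STy} (h : ASrtHasSKind Sg Γ Q a l) :
    ASrtHasSKind Sg Δ (Q.ren ρ) a l := by
  induction h with
  | const h h' => exact .const h h'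
  | app _ h ih => exact .app ih (h.ren hr)

theorem SrtSRefines.ren {Sg : Sig} {ρ : ℕ → ℕ} {Γ Δ : List STy} (hr : SRen ρ Γ Δ) {S : Srt}
    {α : STy} (h : SrtSRefines Sg Γ S α) : SrtSRefines Sg Δ (S.ren ρ) α := by
  induction h generalizing ρ Δ with
  | atm h => exact .atm (h.ren hr)
  | @pi _ _ _ A _ _ h _ ih₁ ih₂ =>
    rw [← Ty.simple_ren ρ A]
    exact .pi (by rw [Ty.simple_ren]; exact ih₁ hr) (h.ren hr)
      (by rw [Ty.simple_ren]; exact ih₂ (hr.up _))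
  | top => exact .top
  | inter _ _ ih₁ ih₂ => exact .inter (ih₁ hr) (ih₂ hr)

theorem TySWf.append {Sg : Sig} {Γ : List STy} (Δ : List STy) {A : Ty} (h : TySWf Sg Γ A) :
    TySWf Sg (Γ ++ Δ) A := by
  simpa only [Ty.ren_id] using h.ren (.append Γ Δ)

theorem SrtSRefines.append {Sg : Sig} {Γ : List STy} (Δ : List STy) {S : Srt} {α : STy}
    (h : SrtSRefines Sg Γ S α) : SrtSRefines Sg (Γ ++ Δ) S α := by
  simpa only [Srt.ren_id] using h.ren (.append Γ Δ)

theorem KindSWf.append {Sg : Sig} {Γ : List STy} (Δ : List STy) {K : Kind}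
    (h : KindSWf Sg Γ K) : KindSWf Sg (Γ ++ Δ) K := by
  induction h with
  | type => exact .type
  | pi h _ ih => exact .pi (h.append Δ) ih

theorem ClsSRefines.append {Sg : Sig} {Γ : List STy} (Δ : List STy) {L : Cls} {l : List STy}
    (h : ClsSRefines Sg Γ L l) : ClsSRefines Sg (Γ ++ Δ) L l := by
  induction h with
  | sort => exact .sort
  | pi h₁ h₂ _ ih => exact .pi (h₁.append Δ) (h₂.append Δ) ih
  | top => exact .top
  | inter _ _ ih₁ ih₂ => exact .inter ih₁ ih₂

/-! ### Scoping -/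

theorem upRen_eq_self {ρ : ℕ → ℕ} {n : ℕ} (h : ∀ i < n, ρ i = i) :
    ∀ i < n + 1, upRen ρ i = i := by
  intro i hi
  cases i with
  | zero => rfl
  | succ i => simp [upRen, h i (by omega)]

mutual
theorem AtmHasSTy.ren_eq {Sg : Sig} {ρ : ℕ → ℕ} {Γ : List STy} (hr : ∀ i < Γ.length, ρ i = i)
    {R : Atm} {α : STy} : AtmHasSTy Sg Γ R α → R.ren ρ = R
  | .const h => rfl
  | .var h => by rw [Atm.ren, hr _ (List.getElem?_eq_some_iff.1 h).1]
  | .app h₁ h₂ => by rw [Atm.ren, h₁.ren_eq hr, h₂.ren_eq hr]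
theorem NrmHasSTy.ren_eq {Sg : Sig} {ρ : ℕ → ℕ} {Γ : List STy} (hr : ∀ i < Γ.length, ρ i = i)
    {N : Nrm} {α : STy} : NrmHasSTy Sg Γ N α → N.ren ρ = N
  | .atm h => by rw [Nrm.ren, h.ren_eq hr]
  | .lam h => by rw [Nrm.ren, NrmHasSTy.ren_eq (Γ := _ :: Γ) (upRen_eq_self hr) h]
end

theorem ATyHasSKind.ren_eq {Sg : Sig} {ρ : ℕ → ℕ} {Γ : List STy}
    (hr : ∀ i < Γ.length, ρ i = i) {P : ATy} {l : List STy} (h : ATyHasSKind Sg Γ P l) :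
    P.ren ρ = P := by
  induction h with
  | const h => rfl
  | app _ h ih => rw [ATy.ren, ih, h.ren_eq hr]

theorem TySWf.ren_eq {Sg : Sig} {ρ : ℕ → ℕ} {Γ : List STy} (hr : ∀ i < Γ.length, ρ i = i)
    {A : Ty} (h : TySWf Sg Γ A) : A.ren ρ = A := by
  induction h generalizing ρ with
  | atm h => rw [Ty.ren, h.ren_eq hr]
  | pi _ _ ih₁ ih₂ => rw [Ty.ren, ih₁ hr, ih₂ (upRen_eq_self hr)]

theorem ASrtHasSKind.ren_eq {Sg : Sig} {ρ : ℕ → ℕ} {Γ : List STy}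
    (hr : ∀ i < Γ.length, ρ i = i) {Q : ASrt} {a : TyConst} {l : List STy}
    (h : ASrtHasSKind Sg Γ Q a l) : Q.ren ρ = Q := by
  induction h with
  | const h => rfl
  | app _ h ih => rw [ASrt.ren, ih, h.ren_eq hr]

theorem SrtSRefines.ren_eq {Sg : Sig} {ρ : ℕ → ℕ} {Γ : List STy}
    (hr : ∀ i < Γ.length, ρ i = i) {S : Srt} {α : STy} (h : SrtSRefines Sg Γ S α) :
    S.ren ρ = S := by
  induction h generalizing ρ with
  | atm h => rw [Srt.ren, h.ren_eq hr]
  | pi _ h _ ih₁ ih₂ => rw [Srt.ren, ih₁ hr, h.ren_eq hr, ih₂ (upRen_eq_self hr)]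
  | top => rfl
  | inter _ _ ih₁ ih₂ => rw [Srt.ren, ih₁ hr, ih₂ hr]

/-- The renaming that skips the variable `k`. -/
def skip (k i : ℕ) : ℕ := if i < k then i else i + 1

theorem varSub_skip (k i : ℕ) : VarSub k (skip k i) (id i) := by
  unfold VarSub skip; split <;> simp <;> omega

theorem skip_eq_self {k n : ℕ} (h : n ≤ k) (i : ℕ) (hi : i < n) : skip k i = i :=
  if_pos (by omega)

theorem TySWf.hsubstA_self {Sg : Sig} {Γ : List STy} {A : Ty} (h : TySWf Sg Γ A) {N₀ : Nrm}
    {k : ℕ} {α : STy} (hk : Γ.length ≤ k) : HSubstA N₀ k α A A := by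
  have := HSubstA.vacuous (N₀ := N₀) (α := α) (varSub_skip k) A
  rwa [h.ren_eq (skip_eq_self hk), Ty.ren_id] at this

theorem SrtSRefines.hsubstS_self {Sg : Sig} {Γ : List STy} {S : Srt} {β : STy}
    (h : SrtSRefines Sg Γ S β) {N₀ : Nrm} {k : ℕ} {α : STy} (hk : Γ.length ≤ k) :
    HSubstS N₀ k α S S := by
  have := HSubstS.vacuous (N₀ := N₀) (α := α) (varSub_skip k) S
  rwa [h.ren_eq (skip_eq_self hk), Srt.ren_id] at this

theorem KindSWf.hsubstK_self {Sg : Sig} {Γ : List STy} {K : Kind} (h : KindSWf Sg Γ K) {N₀ : Nrm}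
    {k : ℕ} {α : STy} (hk : Γ.length ≤ k) : HSubstK N₀ k α K K := by
  induction h generalizing k with
  | type => exact .type
  | pi h _ ih => exact .pi (h.hsubstA_self hk) (ih (Nat.succ_le_succ hk))

theorem ClsSRefines.hsubstL_self {Sg : Sig} {Γ : List STy} {L : Cls} {l : List STy}
    (h : ClsSRefines Sg Γ L l) {N₀ : Nrm} {k : ℕ} {α : STy} (hk : Γ.length ≤ k) :
    HSubstL N₀ k α L L := by
  induction h generalizing k with
  | sort => exact .sort
  | pi h₁ h₂ _ ih =>
    exact .pi (h₁.hsubstS_self hk) (h₂.hsubstA_self hk) (ih (Nat.succ_le_succ hk))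
  | top => exact .top
  | inter _ _ ih₁ ih₂ => exact .inter (ih₁ hk) (ih₂ hk)

/-! ### Hereditary substitution into simply typed syntax -/

theorem VarSub.succ_cases {k i i' : ℕ} (h : VarSub (k + 1) i i') :
    (i = 0 ∧ i' = 0) ∨ ∃ j j', i = j + 1 ∧ i' = j' + 1 ∧ VarSub k j j' := by
  rcases h with ⟨h, rfl⟩ | ⟨h, rfl⟩
  · cases i' with
    | zero => exact .inl ⟨rfl, rfl⟩
    | succ i => exact .inr ⟨i, i, rfl, rfl, .inl ⟨by omega, rfl⟩⟩
  · exact .inr ⟨i', i' - 1, rfl, by omega, .inr ⟨by omega, by omega⟩⟩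

theorem varSub_zero {i i' : ℕ} (h : VarSub 0 i i') : i = i' + 1 := by
  unfold VarSub at h; omega

/-- Substituting `N₀` of simple type `α₀` for the variable `k` leads from `Γ` to `Γ'`. -/
structure SSub (Sg : Sig) (Γ Γ' : List STy) (k : ℕ) (N₀ : Nrm) (α₀ : STy) : Prop where
  target : Γ[k]? = some α₀
  var : ∀ ⦃i i' α⦄, VarSub k i i' → Γ[i]? = some α → Γ'[i']? = some α
  term : NrmHasSTy Sg Γ' (N₀.shift k) α₀

theorem SSub.zero {Sg : Sig} {Γ : List STy} {N₀ : Nrm} {α₀ : STy} (h : NrmHasSTy Sg Γ N₀ α₀) :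
    SSub Sg (α₀ :: Γ) Γ 0 N₀ α₀ where
  target := rfl
  var i i' α hi h := by rw [varSub_zero hi] at h; exact h
  term := by rwa [Nrm.shift_zero]

theorem SSub.up {Sg : Sig} {Γ Γ' : List STy} {k : ℕ} {N₀ : Nrm} {α₀ : STy}
    (h : SSub Sg Γ Γ' k N₀ α₀) (α : STy) : SSub Sg (α :: Γ) (α :: Γ') (k + 1) N₀ α₀ where
  target := h.target
  var i i' β hi hβ := by
    rcases hi.succ_cases with ⟨rfl, rfl⟩ | ⟨j, j', rfl, rfl, hj⟩
    · exact hβ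
    · exact h.var hj hβ
  term := by
    rw [Nrm.shift_succ]
    exact h.term.ren (.succ α Γ')

/-- Hereditary substitution at type `α₀` is defined on simply typed normal terms. -/
def STotal (Sg : Sig) (α₀ : STy) : Prop :=
  ∀ ⦃Γ Γ' k N₀ N β⦄, SSub Sg Γ Γ' k N₀ α₀ → NrmHasSTy Sg Γ N β →
    ∃ N', HSubstN N₀ k α₀ N N' ∧ NrmHasSTy Sg Γ' N' β

mutual
theorem AtmHasSTy.hsubst_of_total {Sg : Sig} {α₀ : STy}
    (ih : ∀ α : STy, sizeOf α < sizeOf α₀ → STotal Sg α) {Γ Γ' : List STy} {k : ℕ} {N₀ : Nrm}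
    (hs : SSub Sg Γ Γ' k N₀ α₀) {R : Atm} {β : STy} : AtmHasSTy Sg Γ R β →
    (∃ R', HSubstRR N₀ k α₀ R R' ∧ AtmHasSTy Sg Γ' R' β) ∨
      ∃ N', HSubstRN N₀ k α₀ R N' β ∧ NrmHasSTy Sg Γ' N' β
  | .const h => .inl ⟨_, .const, .const h⟩
  | .var (i := i) h => by
    rcases Nat.lt_trichotomy i k with hi | rfl | hi
    · exact .inl ⟨_, .varLt hi, .var (hs.var (.inl ⟨hi, rfl⟩) h)⟩
    · obtain rfl : α₀ = β := Option.some.inj (hs.target.symm.trans h)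
      exact .inr ⟨_, .var, hs.term⟩
    · obtain ⟨i, rfl⟩ : ∃ j, i = j + 1 := ⟨i - 1, by omega⟩
      exact .inl ⟨_, .varGt (by omega), .var (hs.var (.inr ⟨by omega, rfl⟩) h)⟩
  | .app h₁ h₂ => by
    obtain ⟨N', hN, hN'⟩ := NrmHasSTy.hsubst_of_total ih hs h₂
    rcases AtmHasSTy.hsubst_of_total ih hs h₁ with ⟨R', hR, hR'⟩ | ⟨M, hM, hM'⟩
    · exact .inl ⟨_, .app hR hN, .app hR' hN'⟩
    · have hle := hM.sizeOf_le
      simp only [STy.arrow.sizeOf_spec] at hle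
      cases hM' with
      | lam hM' =>
        obtain ⟨M', h, h'⟩ := ih _ (by omega) (.zero hN') hM'
        exact .inr ⟨M', .beta hM hN h, h'⟩
theorem NrmHasSTy.hsubst_of_total {Sg : Sig} {α₀ : STy}
    (ih : ∀ α : STy, sizeOf α < sizeOf α₀ → STotal Sg α) {Γ Γ' : List STy} {k : ℕ} {N₀ : Nrm}
    (hs : SSub Sg Γ Γ' k N₀ α₀) {N : Nrm} {β : STy} : NrmHasSTy Sg Γ N β →
    ∃ N', HSubstN N₀ k α₀ N N' ∧ NrmHasSTy Sg Γ' N' β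
  | .atm h => by
    rcases AtmHasSTy.hsubst_of_total ih hs h with ⟨R', hR, hR'⟩ | ⟨M, hM, hM'⟩
    · exact ⟨_, .atm hR, .atm hR'⟩
    · cases hM' with
      | atm hM' => exact ⟨_, .atmNorm hM, .atm hM'⟩
  | .lam h => by
    obtain ⟨N', hN, hN'⟩ := NrmHasSTy.hsubst_of_total ih (hs.up _) h
    exact ⟨_, .lam hN, .lam hN'⟩
end

theorem sTotal (Sg : Sig) (α₀ : STy) : STotal Sg α₀ := by
  induction hn : sizeOf α₀ using Nat.strong_induction_on generalizing α₀ with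
  | _ n ih =>
    intro Γ Γ' k N₀ N β hs h
    exact h.hsubst_of_total (fun α hα => ih _ (hn ▸ hα) α rfl) hs

section

variable {Sg : Sig} {α₀ : STy} {Γ Γ' : List STy} {k : ℕ} {N₀ : Nrm}

theorem NrmHasSTy.hsubst (hs : SSub Sg Γ Γ' k N₀ α₀) {N : Nrm} {β : STy}
    (h : NrmHasSTy Sg Γ N β) : ∃ N', HSubstN N₀ k α₀ N N' ∧ NrmHasSTy Sg Γ' N' β :=
  sTotal Sg α₀ hs h

theorem AtmHasSTy.hsubst (hs : SSub Sg Γ Γ' k N₀ α₀) {R : Atm} {β : STy}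
    (h : AtmHasSTy Sg Γ R β) :
    (∃ R', HSubstRR N₀ k α₀ R R' ∧ AtmHasSTy Sg Γ' R' β) ∨
      ∃ N', HSubstRN N₀ k α₀ R N' β ∧ NrmHasSTy Sg Γ' N' β :=
  h.hsubst_of_total (fun α _ => sTotal Sg α) hs

theorem ATyHasSKind.hsubst (hs : SSub Sg Γ Γ' k N₀ α₀) {P : ATy} {l : List STy}
    (h : ATyHasSKind Sg Γ P l) : ∃ P', HSubstP N₀ k α₀ P P' ∧ ATyHasSKind Sg Γ' P' l := by
  induction h with
  | const h => exact ⟨_, .const, .const h⟩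
  | app _ h ih =>
    obtain ⟨_, h₁, h₁'⟩ := ih
    obtain ⟨_, h₂, h₂'⟩ := h.hsubst hs
    exact ⟨_, .app h₁ h₂, .app h₁' h₂'⟩

theorem TySWf.hsubst (hs : SSub Sg Γ Γ' k N₀ α₀) {A : Ty} (h : TySWf Sg Γ A) :
    ∃ A', HSubstA N₀ k α₀ A A' ∧ TySWf Sg Γ' A' := by
  induction h generalizing Γ' k with
  | atm h =>
    obtain ⟨_, h, h'⟩ := h.hsubst hs
    exact ⟨_, .atm h, .atm h'⟩
  | pi _ _ ih₁ ih₂ =>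
    obtain ⟨_, h₁, h₁'⟩ := ih₁ hs
    obtain ⟨_, h₂, h₂'⟩ := ih₂ (hs.up _)
    exact ⟨_, .pi h₁ h₂, .pi h₁' (by rwa [h₁.simple_eq])⟩

theorem KindSWf.hsubst (hs : SSub Sg Γ Γ' k N₀ α₀) {K : Kind} (h : KindSWf Sg Γ K) :
    ∃ K', HSubstK N₀ k α₀ K K' ∧ KindSWf Sg Γ' K' := by
  induction h generalizing Γ' k with
  | type => exact ⟨_, .type, .type⟩
  | pi h _ ih =>
    obtain ⟨_, h₁, h₁'⟩ := h.hsubst hs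
    obtain ⟨_, h₂, h₂'⟩ := ih (hs.up _)
    exact ⟨_, .pi h₁ h₂, .pi h₁' (by rwa [h₁.simple_eq])⟩

theorem ASrtHasSKind.hsubst (hs : SSub Sg Γ Γ' k N₀ α₀) {Q : ASrt} {a : TyConst} {l : List STy}
    (h : ASrtHasSKind Sg Γ Q a l) :
    ∃ Q', HSubstQ N₀ k α₀ Q Q' ∧ ASrtHasSKind Sg Γ' Q' a l := by
  induction h with
  | const h h' => exact ⟨_, .const, .const h h'⟩
  | app _ h ih =>
    obtain ⟨_, h₁, h₁'⟩ := ih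
    obtain ⟨_, h₂, h₂'⟩ := h.hsubst hs
    exact ⟨_, .app h₁ h₂, .app h₁' h₂'⟩

theorem SrtSRefines.hsubst (hs : SSub Sg Γ Γ' k N₀ α₀) {S : Srt} {β : STy}
    (h : SrtSRefines Sg Γ S β) : ∃ S', HSubstS N₀ k α₀ S S' ∧ SrtSRefines Sg Γ' S' β := by
  induction h generalizing Γ' k with
  | atm h =>
    obtain ⟨_, h, h'⟩ := h.hsubst hs
    exact ⟨_, .atm h, .atm h'⟩
  | pi _ h _ ih₁ ih₂ =>
    obtain ⟨_, h₁, h₁'⟩ := ih₁ hs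
    obtain ⟨_, h₂, h₂'⟩ := h.hsubst hs
    obtain ⟨_, h₃, h₃'⟩ := ih₂ (hs.up _)
    refine ⟨_, .pi h₁ h₂ h₃, ?_⟩
    rw [← h₂.simple_eq] at h₁' h₃' ⊢
    exact .pi h₁' h₂' h₃'
  | top => exact ⟨_, .top, .top⟩
  | inter _ _ ih₁ ih₂ =>
    obtain ⟨_, h₁, h₁'⟩ := ih₁ hs
    obtain ⟨_, h₂, h₂'⟩ := ih₂ hs
    exact ⟨_, .inter h₁ h₂, .inter h₁' h₂'⟩

theorem ClsSRefines.hsubst (hs : SSub Sg Γ Γ' k N₀ α₀) {L : Cls} {l : List STy}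
    (h : ClsSRefines Sg Γ L l) : ∃ L', HSubstL N₀ k α₀ L L' ∧ ClsSRefines Sg Γ' L' l := by
  induction h generalizing Γ' k with
  | sort => exact ⟨_, .sort, .sort⟩
  | pi hS hA _ ih =>
    obtain ⟨_, h₁, h₁'⟩ := hS.hsubst hs
    obtain ⟨_, h₂, h₂'⟩ := hA.hsubst hs
    obtain ⟨_, h₃, h₃'⟩ := ih (hs.up _)
    refine ⟨_, .pi h₁ h₂ h₃, ?_⟩
    rw [← h₂.simple_eq] at h₁' h₃' ⊢
    exact .pi h₁' h₂' h₃'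
  | top => exact ⟨_, .top, .top⟩
  | inter _ _ ih₁ ih₂ =>
    obtain ⟨_, h₁, h₁'⟩ := ih₁ hs
    obtain ⟨_, h₂, h₂'⟩ := ih₂ hs
    exact ⟨_, .inter h₁ h₂, .inter h₁' h₂'⟩

theorem NrmHasSTy.of_hsubst (hs : SSub Sg Γ Γ' k N₀ α₀) {N N' : Nrm} {β : STy}
    (h : NrmHasSTy Sg Γ N β) (h' : HSubstN N₀ k α₀ N N') : NrmHasSTy Sg Γ' N' β := by
  obtain ⟨_, h₁, h₂⟩ := h.hsubst hs
  rwa [h'.unique h₁]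

theorem TySWf.of_hsubst (hs : SSub Sg Γ Γ' k N₀ α₀) {A A' : Ty} (h : TySWf Sg Γ A)
    (h' : HSubstA N₀ k α₀ A A') : TySWf Sg Γ' A' := by
  obtain ⟨_, h₁, h₂⟩ := h.hsubst hs
  rwa [h'.unique h₁]

theorem KindSWf.of_hsubst (hs : SSub Sg Γ Γ' k N₀ α₀) {K K' : Kind} (h : KindSWf Sg Γ K)
    (h' : HSubstK N₀ k α₀ K K') : KindSWf Sg Γ' K' := by
  obtain ⟨_, h₁, h₂⟩ := h.hsubst hs
  rwa [h'.unique h₁]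

theorem SrtSRefines.of_hsubst (hs : SSub Sg Γ Γ' k N₀ α₀) {S S' : Srt} {β : STy}
    (h : SrtSRefines Sg Γ S β) (h' : HSubstS N₀ k α₀ S S') : SrtSRefines Sg Γ' S' β := by
  obtain ⟨_, h₁, h₂⟩ := h.hsubst hs
  rwa [h'.unique h₁]

theorem ClsSRefines.of_hsubst (hs : SSub Sg Γ Γ' k N₀ α₀) {L L' : Cls} {l : List STy}
    (h : ClsSRefines Sg Γ L l) (h' : HSubstL N₀ k α₀ L L') : ClsSRefines Sg Γ' L' l := by
  obtain ⟨_, h₁, h₂⟩ := h.hsubst hs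
  rwa [h'.unique h₁]

/-- A simply typed atomic term with the head that is replaced becomes a normal term of the same
simple type. -/
theorem AtmHasSTy.of_hsubstRN (hs : SSub Sg Γ Γ' k N₀ α₀) {R : Atm} {N : Nrm} {β β' : STy}
    (h : AtmHasSTy Sg Γ R β) (h' : HSubstRN N₀ k α₀ R N β') :
    β' = β ∧ NrmHasSTy Sg Γ' N β := by
  rcases h.hsubst hs with ⟨_, h₁, _⟩ | ⟨_, h₁, h₂⟩
  · exact (h₁.not_hsubstRN h').elim
  · obtain ⟨rfl, rfl⟩ := h'.unique h₁
    exact ⟨rfl, h₂⟩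

end

/-! ### From dependent typing to simple typing -/

/-- The simple types of an LF context. -/
abbrev LFCtx.simple (Γ : LFCtx) : List STy := List.map Ty.simple Γ

/-- The simple types of an LFR context. -/
abbrev Ctx.simple (Γ : Ctx) : List STy := LFCtx.simple (Ctx.erase Γ)

theorem tm_mem_erase {Sg : Sig} {c : TmConst} {A : Ty} :
    LFDecl.tm c A ∈ Sig.erase Sg ↔ Decl.tm c A ∈ Sg := by
  simp only [Sig.erase, List.mem_filterMap]
  constructor
  · rintro ⟨d, hd, h⟩
    cases d <;> simp [Decl.erase] at h
    obtain ⟨rfl, rfl⟩ := h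
    exact hd
  · exact fun h => ⟨_, h, rfl⟩

theorem ty_mem_erase {Sg : Sig} {a : TyConst} {K : Kind} :
    LFDecl.ty a K ∈ Sig.erase Sg ↔ Decl.ty a K ∈ Sg := by
  simp only [Sig.erase, List.mem_filterMap]
  constructor
  · rintro ⟨d, hd, h⟩
    cases d <;> simp [Decl.erase] at h
    obtain ⟨rfl, rfl⟩ := h
    exact hd
  · exact fun h => ⟨_, h, rfl⟩

mutual
theorem LFSynth.hasSTy {Sg : Sig} {Γ : LFCtx} {R : Atm} {A : Ty} :
    LFSynth (Sig.erase Sg) Γ R A → AtmHasSTy Sg (LFCtx.simple Γ) R A.simple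
  | .const h => .const (tm_mem_erase.1 h)
  | .var h => .var (by rw [List.getElem?_map, h, Ty.shift, Ty.simple_ren]; rfl)
  | .app h₁ h₂ h₃ => by
    rw [h₃.simple_eq]
    exact .app h₁.hasSTy h₂.hasSTy
theorem LFCheck.hasSTy {Sg : Sig} {Γ : LFCtx} {N : Nrm} {A : Ty} :
    LFCheck (Sig.erase Sg) Γ N A → NrmHasSTy Sg (LFCtx.simple Γ) N A.simple
  | .atm h => .atm h.hasSTy
  | .lam h => .lam h.hasSTy
end

theorem HSubstK.simple_eq {N₀ : Nrm} {k : ℕ} {α : STy} {K K' : Kind} (h : HSubstK N₀ k α K K') :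
    K'.simple = K.simple := by
  induction h with
  | type => rfl
  | pi h _ ih => rw [Kind.simple, h.simple_eq, ih, Kind.simple]

theorem LFSynthKind.hasSKind {Sg : Sig} {Γ : LFCtx} {P : ATy} {K : Kind}
    (h : LFSynthKind (Sig.erase Sg) Γ P K) : ATyHasSKind Sg (LFCtx.simple Γ) P K.simple := by
  induction h with
  | const h => exact .const (ty_mem_erase.1 h)
  | app _ h₁ h₂ ih =>
    rw [h₂.simple_eq]
    exact .app ih h₁.hasSTy

theorem LFTyWf.swf {Sg : Sig} {Γ : LFCtx} {A : Ty} (h : LFTyWf (Sig.erase Sg) Γ A) :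
    TySWf Sg (LFCtx.simple Γ) A := by
  induction h with
  | atm h => exact .atm h.hasSKind
  | pi _ _ ih₁ ih₂ => exact .pi ih₁ ih₂

theorem LFKindWf.swf {Sg : Sig} {Γ : LFCtx} {K : Kind} (h : LFKindWf (Sig.erase Sg) Γ K) :
    KindSWf Sg (LFCtx.simple Γ) K := by
  induction h with
  | type => exact .type
  | pi h _ ih => exact .pi h.swf ih

theorem SynthCls.hasSKind {Sg : Sig} {Γ : Ctx} {Δ : List STy} {Q : ASrt} {P : ATy} {L : Cls}
    {l : List STy} (h : SynthCls Sg Γ Q P L) (hP : ATyHasSKind Sg Δ P l) :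
    ASrtHasSKind Sg Δ Q P.head l := by
  induction h generalizing l with
  | const h => cases hP with | const h' => exact .const h h'
  | app _ _ _ ih => cases hP with | app h₁ h₂ => exact .app (ih h₁) h₂
  | interE₁ _ ih => exact ih hP
  | interE₂ _ ih => exact ih hP

theorem Refines.srefines {Sg : Sig} {Γ : Ctx} {S : Srt} {A : Ty} (h : Refines Sg Γ S A)
    (hA : TySWf Sg (Ctx.simple Γ) A) : SrtSRefines Sg (Ctx.simple Γ) S A.simple := by
  induction h with
  | atm h => cases hA with | atm hA => exact .atm (h.hasSKind hA)
  | pi _ _ ih₁ ih₂ => cases hA with | pi h₁ h₂ => exact .pi (ih₁ h₁) h₁ (ih₂ h₂)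
  | top => exact .top
  | inter _ _ ih₁ ih₂ => exact .inter (ih₁ hA) (ih₂ hA)

theorem RefinesCls.srefines {Sg : Sig} {Γ : Ctx} {L : Cls} {K : Kind} (h : RefinesCls Sg Γ L K)
    (hK : KindSWf Sg (Ctx.simple Γ) K) : ClsSRefines Sg (Ctx.simple Γ) L K.simple := by
  induction h with
  | sort => exact .sort
  | pi h _ ih => cases hK with | pi h₁ h₂ => exact .pi (h.srefines h₁) h₁ (ih h₂)
  | top => exact .top
  | inter _ _ ih₁ ih₂ => exact .inter (ih₁ hK) (ih₂ hK)

/-! ### Signatures -/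

/-- What simple typing needs to know about a signature. -/
structure SigSWf (Sg : Sig) : Prop where
  ty_unique : ∀ ⦃a K K'⦄, Decl.ty a K ∈ Sg → Decl.ty a K' ∈ Sg → K = K'
  tm_unique : ∀ ⦃c A A'⦄, Decl.tm c A ∈ Sg → Decl.tm c A' ∈ Sg → A = A'
  ty : ∀ ⦃a K⦄, Decl.ty a K ∈ Sg → KindSWf Sg [] K
  tm : ∀ ⦃c A⦄, Decl.tm c A ∈ Sg → TySWf Sg [] A
  srt : ∀ ⦃s a L⦄, Decl.srt s a L ∈ Sg → ∃ K, Decl.ty a K ∈ Sg ∧ ClsSRefines Sg [] L K.simple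
  tmSrt : ∀ ⦃c S⦄, Decl.tmSrt c S ∈ Sg → ∃ A, Decl.tm c A ∈ Sg ∧ SrtSRefines Sg [] S A.simple

/-- Extension of a signature by one declaration that is well-formed in it. -/
theorem SigSWf.cons {Sg : Sig} {d : Decl} (h : SigSWf Sg)
    (ty_new : ∀ a K, d = .ty a K → KindSWf Sg [] K ∧ ∀ K', Decl.ty a K' ∉ Sg)
    (tm_new : ∀ c A, d = .tm c A → TySWf Sg [] A ∧ ∀ A', Decl.tm c A' ∉ Sg)
    (srt_new : ∀ s a L, d = .srt s a L →
      ∃ K, Decl.ty a K ∈ Sg ∧ ClsSRefines Sg [] L K.simple)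
    (tmSrt_new : ∀ c S, d = .tmSrt c S →
      ∃ A, Decl.tm c A ∈ Sg ∧ SrtSRefines Sg [] S A.simple) : SigSWf (d :: Sg) where
  ty_unique a K K' hK hK' := by
    rcases List.mem_cons.1 hK with hK | hK <;> rcases List.mem_cons.1 hK' with hK' | hK'
    · cases hK.trans hK'.symm; rfl
    · exact ((ty_new _ _ hK.symm).2 _ hK').elim
    · exact ((ty_new _ _ hK'.symm).2 _ hK).elim
    · exact h.ty_unique hK hK'
  tm_unique c A A' hA hA' := by
    rcases List.mem_cons.1 hA with hA | hA <;> rcases List.mem_cons.1 hA' with hA' | hA'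
    · cases hA.trans hA'.symm; rfl
    · exact ((tm_new _ _ hA.symm).2 _ hA').elim
    · exact ((tm_new _ _ hA'.symm).2 _ hA).elim
    · exact h.tm_unique hA hA'
  ty a K hK := by
    refine KindSWf.mono (List.subset_cons_self _ _) ?_
    rcases List.mem_cons.1 hK with hK | hK
    exacts [(ty_new _ _ hK.symm).1, h.ty hK]
  tm c A hA := by
    refine TySWf.mono (List.subset_cons_self _ _) ?_
    rcases List.mem_cons.1 hA with hA | hA
    exacts [(tm_new _ _ hA.symm).1, h.tm hA]
  srt s a L hL := by
    obtain ⟨K, hK, hL⟩ : ∃ K, Decl.ty a K ∈ Sg ∧ ClsSRefines Sg [] L K.simple := by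
      rcases List.mem_cons.1 hL with hL | hL
      exacts [srt_new _ _ _ hL.symm, h.srt hL]
    exact ⟨K, List.mem_cons_of_mem _ hK, hL.mono (List.subset_cons_self _ _)⟩
  tmSrt c S hS := by
    obtain ⟨A, hA, hS⟩ : ∃ A, Decl.tm c A ∈ Sg ∧ SrtSRefines Sg [] S A.simple := by
      rcases List.mem_cons.1 hS with hS | hS
      exacts [tmSrt_new _ _ hS.symm, h.tmSrt hS]
    exact ⟨A, List.mem_cons_of_mem _ hA, hS.mono (List.subset_cons_self _ _)⟩

theorem SigWf.swf {Sg : Sig} (h : SigWf Sg) : SigSWf Sg := by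
  induction h with
  | nil => constructor <;> simp
  | ty _ hK hn ih =>
    refine ih.cons ?_ (fun _ _ e => nomatch e) (fun _ _ _ e => nomatch e)
      (fun _ _ e => nomatch e)
    rintro _ _ ⟨⟩
    exact ⟨hK.swf, hn⟩
  | tm _ hA hn ih =>
    refine ih.cons (fun _ _ e => nomatch e) ?_ (fun _ _ _ e => nomatch e)
      (fun _ _ e => nomatch e)
    rintro _ _ ⟨⟩
    exact ⟨hA.swf, hn⟩
  | srt _ ha hL _ ih =>
    refine ih.cons (fun _ _ e => nomatch e) (fun _ _ e => nomatch e) ?_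
      (fun _ _ e => nomatch e)
    rintro _ _ _ ⟨⟩
    exact ⟨_, ha, hL.srefines (ih.ty ha)⟩
  | tmSrt _ hc hS _ ih =>
    refine ih.cons (fun _ _ e => nomatch e) (fun _ _ e => nomatch e)
      (fun _ _ _ e => nomatch e) ?_
    rintro _ _ ⟨⟩
    exact ⟨_, hc, hS.srefines (ih.tm hc)⟩
  | sub _ _ _ ih =>
    exact ih.cons (fun _ _ e => nomatch e) (fun _ _ e => nomatch e)
      (fun _ _ _ e => nomatch e) (fun _ _ e => nomatch e)

/-! ### Regularity with respect to simple types -/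

/-- The types in the LF context `Γ` are well-formed with respect to simple types. -/
def LFCtxSWf (Sg : Sig) (Γ : LFCtx) : Prop :=
  ∀ ⦃i : ℕ⦄ ⦃A : Ty⦄, Γ[i]? = some A → TySWf Sg (LFCtx.simple Γ) (A.shift (i + 1))

/-- The sorts in the LFR context `Γ` refine the simple types of their variables. -/
def CtxSWf (Sg : Sig) (Γ : Ctx) : Prop :=
  ∀ ⦃i : ℕ⦄ ⦃S : Srt⦄ ⦃A : Ty⦄, Γ[i]? = some (S, A) →
    SrtSRefines Sg (Ctx.simple Γ) (S.shift (i + 1)) A.simple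

theorem LFCtxSWf.cons {Sg : Sig} {Γ : LFCtx} {A : Ty} (h : LFCtxSWf Sg Γ)
    (hA : TySWf Sg (LFCtx.simple Γ) A) : LFCtxSWf Sg (A :: Γ) := by
  intro i B hi
  cases i with
  | zero =>
    cases hi
    exact hA.ren (.succ _ _)
  | succ i =>
    rw [Ty.shift_succ]
    exact (h hi).ren (.succ _ _)

theorem CtxSWf.cons {Sg : Sig} {Γ : Ctx} {S : Srt} {A : Ty} (h : CtxSWf Sg Γ)
    (hS : SrtSRefines Sg (Ctx.simple Γ) S A.simple) : CtxSWf Sg ((S, A) :: Γ) := by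
  intro i T B hi
  cases i with
  | zero =>
    cases hi
    exact hS.ren (.succ _ _)
  | succ i =>
    rw [Srt.shift_succ]
    exact (h hi).ren (.succ _ _)

theorem LFCtxWf.swf {Sg : Sig} {Γ : LFCtx} (h : LFCtxWf (Sig.erase Sg) Γ) : LFCtxSWf Sg Γ := by
  induction Γ with
  | nil => intro i A hi; simp at hi
  | cons A Γ ih => cases h with | cons h hA => exact (ih h).cons hA.swf

theorem CtxWf.swf {Sg : Sig} {Γ : Ctx} (h : CtxWf Sg Γ)
    (h' : LFCtxWf (Sig.erase Sg) (Ctx.erase Γ)) : CtxSWf Sg Γ := by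
  induction h with
  | nil => intro i S A hi; simp at hi
  | cons _ hS ih => cases h' with | cons h hA => exact (ih h).cons (hS.srefines hA.swf)

theorem Ctx.simple_getElem? {Γ : Ctx} {i : ℕ} {S : Srt} {A : Ty} (h : Γ[i]? = some (S, A)) :
    (Ctx.simple Γ)[i]? = some A.simple := by
  simp [Ctx.simple, Ctx.erase, h]

theorem LFSynth.swf {Sg : Sig} (hSg : SigSWf Sg) {Γ : LFCtx} (hΓ : LFCtxSWf Sg Γ) {R : Atm}
    {A : Ty} : LFSynth (Sig.erase Sg) Γ R A → TySWf Sg (LFCtx.simple Γ) A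
  | .const h => (hSg.tm (tm_mem_erase.1 h)).append (LFCtx.simple Γ)
  | .var h => hΓ h
  | .app h₁ h₂ h₃ => by
    cases h₁.swf hSg hΓ with
    | pi _ hB => exact hB.of_hsubst (.zero h₂.hasSTy) h₃

theorem LFSynthKind.swf {Sg : Sig} (hSg : SigSWf Sg) {Γ : LFCtx} {P : ATy}
    {K : Kind} (h : LFSynthKind (Sig.erase Sg) Γ P K) : KindSWf Sg (LFCtx.simple Γ) K := by
  induction h with
  | const h => exact (hSg.ty (ty_mem_erase.1 h)).append _
  | app _ h₂ h₃ ih => cases ih with | pi _ hK => exact hK.of_hsubst (.zero h₂.hasSTy) h₃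

theorem Synth.srefines {Sg : Sig} (hSg : SigSWf Sg) {Γ : Ctx} (hΓ : CtxSWf Sg Γ) {R : Atm}
    {S : Srt} {β : STy} : Synth Sg Γ R S → AtmHasSTy Sg (Ctx.simple Γ) R β →
    SrtSRefines Sg (Ctx.simple Γ) S β
  | .const h, hR => by
    cases hR with
    | const hA =>
      obtain ⟨A, hA', hS⟩ := hSg.tmSrt h
      rw [hSg.tm_unique hA hA']
      exact hS.append (Ctx.simple Γ)
  | .var h, hR => by
    cases hR with
    | var hβ =>
      obtain rfl := Option.some.inj ((Ctx.simple_getElem? h).symm.trans hβ)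
      exact hΓ h
  | .app h₁ _ h₃, hR => by
    cases hR with
    | app hR hN => cases h₁.srefines hSg hΓ hR with
      | pi _ _ hT => exact hT.of_hsubst (.zero hN) h₃
  | .interE₁ h, hR => by cases h.srefines hSg hΓ hR with | inter h _ => exact h
  | .interE₂ h, hR => by cases h.srefines hSg hΓ hR with | inter _ h => exact h

theorem SynthCls.srefines {Sg : Sig} (hSg : SigSWf Sg) {Γ : Ctx} {Q : ASrt} {P : ATy} {L : Cls}
    {l : List STy} (h : SynthCls Sg Γ Q P L) (hP : ATyHasSKind Sg (Ctx.simple Γ) P l) :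
    ClsSRefines Sg (Ctx.simple Γ) L l := by
  induction h generalizing l with
  | const h =>
    cases hP with
    | const hK =>
      obtain ⟨K, hK', hL⟩ := hSg.srt h
      rw [hSg.ty_unique hK hK']
      exact hL.append _
  | app _ _ h₃ ih =>
    cases hP with
    | app hP hN => cases ih hP with
      | pi _ _ hL => exact hL.of_hsubst (.zero hN) h₃
  | interE₁ _ ih => cases ih hP with | inter h _ => exact h
  | interE₂ _ ih => cases ih hP with | inter _ h => exact h

/-! ### Weakening -/

/-- The renaming `ρ` leads from the LF context `Γ` to the LF context `Δ`. -/
def LFRen (ρ : ℕ → ℕ) (Γ Δ : LFCtx) : Prop :=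
  ∀ ⦃i : ℕ⦄ ⦃A : Ty⦄, Γ[i]? = some A →
    ∃ B, Δ[ρ i]? = some B ∧ B.shift (ρ i + 1) = (A.shift (i + 1)).ren ρ

theorem LFRen.up {ρ : ℕ → ℕ} {Γ Δ : LFCtx} (h : LFRen ρ Γ Δ) (A : Ty) :
    LFRen (upRen ρ) (A :: Γ) (A.ren ρ :: Δ) := by
  intro i B hi
  cases i with
  | zero =>
    cases hi
    exact ⟨_, rfl, (Ty.shift_one_ren ρ A).symm⟩
  | succ i =>
    obtain ⟨C, hC, hC'⟩ := h hi
    refine ⟨C, hC, ?_⟩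
    rw [Ty.shift_succ (i + 1), Ty.shift_one_ren, ← hC', ← Ty.shift_succ]
    rfl

theorem LFRen.succ (A : Ty) (Γ : LFCtx) : LFRen (· + 1) Γ (A :: Γ) :=
  fun _ B hi => ⟨B, hi, Ty.shift_succ _ B⟩

mutual
theorem LFSynth.ren {Sg : Sig} (hSg : SigSWf Sg) {ρ : ℕ → ℕ} {Γ Δ : LFCtx} (hr : LFRen ρ Γ Δ)
    {R : Atm} {A : Ty} : LFSynth (Sig.erase Sg) Γ R A →
    LFSynth (Sig.erase Sg) Δ (R.ren ρ) (A.ren ρ)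
  | .const h => by
    rw [(hSg.tm (tm_mem_erase.1 h)).ren_eq (by simp)]
    exact .const h
  | .var h => by
    obtain ⟨B, hB, hB'⟩ := hr h
    rw [← hB']
    exact .var hB
  | .app h₁ h₂ h₃ => .app (h₁.ren hSg hr) (h₂.ren hSg hr)
      (by rw [Ty.simple_ren]; exact h₃.ren (.upRen _ ρ))
theorem LFCheck.ren {Sg : Sig} (hSg : SigSWf Sg) {ρ : ℕ → ℕ} {Γ Δ : LFCtx} (hr : LFRen ρ Γ Δ)
    {N : Nrm} {A : Ty} : LFCheck (Sig.erase Sg) Γ N A →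
    LFCheck (Sig.erase Sg) Δ (N.ren ρ) (A.ren ρ)
  | .atm h => .atm (h.ren hSg hr)
  | .lam h => .lam (h.ren hSg (hr.up _))
end

/-- The renaming `ρ` leads from the LFR context `Γ` to the LFR context `Δ`. -/
def CtxRen (ρ : ℕ → ℕ) (Γ Δ : Ctx) : Prop :=
  ∀ ⦃i : ℕ⦄ ⦃S : Srt⦄ ⦃A : Ty⦄, Γ[i]? = some (S, A) →
    ∃ T B, Δ[ρ i]? = some (T, B) ∧ T.shift (ρ i + 1) = (S.shift (i + 1)).ren ρ

theorem CtxRen.up {ρ : ℕ → ℕ} {Γ Δ : Ctx} (h : CtxRen ρ Γ Δ) (S : Srt) (A : Ty) :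
    CtxRen (upRen ρ) ((S, A) :: Γ) ((S.ren ρ, A.ren ρ) :: Δ) := by
  intro i T B hi
  cases i with
  | zero =>
    cases hi
    exact ⟨_, _, rfl, (Srt.shift_one_ren ρ S).symm⟩
  | succ i =>
    obtain ⟨T', B', hC, hC'⟩ := h hi
    refine ⟨T', B', hC, ?_⟩
    rw [Srt.shift_succ (i + 1), Srt.shift_one_ren, ← hC', ← Srt.shift_succ]
    rfl

theorem CtxRen.succ (S : Srt) (A : Ty) (Γ : Ctx) : CtxRen (· + 1) Γ ((S, A) :: Γ) :=
  fun _ T B hi => ⟨T, B, hi, Srt.shift_succ _ T⟩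

theorem SubStep.ren {Sg : Sig} (ρ : ℕ → ℕ) {Q Q' : ASrt} (h : SubStep Sg Q Q') :
    SubStep Sg (Q.ren ρ) (Q'.ren ρ) := by
  induction h with
  | decl h => exact .decl h
  | app _ ih => exact .app ih

theorem Subsort.ren {Sg : Sig} (ρ : ℕ → ℕ) {Q Q' : ASrt} (h : Subsort Sg Q Q') :
    Subsort Sg (Q.ren ρ) (Q'.ren ρ) := by
  induction h with
  | refl => exact .refl
  | step h _ ih => exact .step (h.ren ρ) ih

mutual
theorem Synth.ren {Sg : Sig} (hSg : SigSWf Sg) {ρ : ℕ → ℕ} {Γ Δ : Ctx} (hr : CtxRen ρ Γ Δ)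
    {R : Atm} {S : Srt} : Synth Sg Γ R S → Synth Sg Δ (R.ren ρ) (S.ren ρ)
  | .const h => by
    obtain ⟨_, _, hS⟩ := hSg.tmSrt h
    rw [hS.ren_eq (by simp)]
    exact .const h
  | .var h => by
    obtain ⟨T, B, hB, hB'⟩ := hr h
    rw [← hB']
    exact .var hB
  | .app h₁ h₂ h₃ => .app (h₁.ren hSg hr) (h₂.ren hSg hr)
      (by rw [Ty.simple_ren]; exact h₃.ren (.upRen _ ρ))
  | .interE₁ h => .interE₁ (h.ren hSg hr)
  | .interE₂ h => .interE₂ (h.ren hSg hr)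
theorem Check.ren {Sg : Sig} (hSg : SigSWf Sg) {ρ : ℕ → ℕ} {Γ Δ : Ctx} (hr : CtxRen ρ Γ Δ)
    {N : Nrm} {S : Srt} : Check Sg Γ N S → Check Sg Δ (N.ren ρ) (S.ren ρ)
  | .switch h h' => .switch (h.ren hSg hr) (h'.ren ρ)
  | .lam h => .lam (h.ren hSg (hr.up _ _))
  | .top => .top
  | .inter h₁ h₂ => .inter (h₁.ren hSg hr) (h₂.ren hSg hr)
end

/-! ### Substitution into LF terms -/

/-- Substituting `N₀` for the variable `k` leads from the LF context `Γ` to the LF context `Γ'`. -/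
structure LFSub (Sg : Sig) (Γ Γ' : LFCtx) (k : ℕ) (N₀ : Nrm) (α₀ : STy) : Prop where
  ssub : SSub Sg (LFCtx.simple Γ) (LFCtx.simple Γ') k N₀ α₀
  swf : LFCtxSWf Sg Γ
  swf' : LFCtxSWf Sg Γ'
  var : ∀ ⦃i i' A⦄, VarSub k i i' → Γ[i]? = some A →
    ∃ B, Γ'[i']? = some B ∧ HSubstA N₀ k α₀ (A.shift (i + 1)) (B.shift (i' + 1))
  target : ∀ ⦃A⦄, Γ[k]? = some A →
    ∃ B, HSubstA N₀ k α₀ (A.shift (k + 1)) B ∧ LFCheck (Sig.erase Sg) Γ' (N₀.shift k) B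

theorem LFSub.zero {Sg : Sig} {Γ : LFCtx} {N₀ : Nrm} {A₀ : Ty} (hΓ : LFCtxSWf Sg Γ)
    (hA : TySWf Sg (LFCtx.simple Γ) A₀) (h : LFCheck (Sig.erase Sg) Γ N₀ A₀) :
    LFSub Sg (A₀ :: Γ) Γ 0 N₀ A₀.simple where
  ssub := .zero h.hasSTy
  swf := hΓ.cons hA
  swf' := hΓ
  var i i' A hi hA := by
    obtain rfl := varSub_zero hi
    exact ⟨A, hA, .vacuous (varSub_shift (Nat.zero_le _)) A⟩
  target A hA := by
    cases hA
    refine ⟨A₀.shift 0, .vacuous (varSub_shift le_rfl) A₀, ?_⟩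
    rwa [Nrm.shift_zero, Ty.shift_zero]

theorem LFSub.up {Sg : Sig} (hSg : SigSWf Sg) {Γ Γ' : LFCtx} {k : ℕ} {N₀ : Nrm} {α₀ : STy}
    (h : LFSub Sg Γ Γ' k N₀ α₀) {A A' : Ty} (hA : TySWf Sg (LFCtx.simple Γ) A)
    (hA' : HSubstA N₀ k α₀ A A') : LFSub Sg (A :: Γ) (A' :: Γ') (k + 1) N₀ α₀ where
  ssub := by
    change SSub Sg (A.simple :: _) (A'.simple :: _) (k + 1) N₀ α₀
    rw [hA'.simple_eq]
    exact h.ssub.up _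
  swf := h.swf.cons hA
  swf' := h.swf'.cons (hA.of_hsubst h.ssub hA')
  var i i' B hi hB := by
    rcases hi.succ_cases with ⟨rfl, rfl⟩ | ⟨j, j', rfl, rfl, hj⟩
    · cases hB
      exact ⟨A', rfl, hA'.ren (.shift N₀ k 1)⟩
    · obtain ⟨C, hC, hC'⟩ := h.var hj hB
      refine ⟨C, hC, ?_⟩
      rw [Ty.shift_succ (j + 1), Ty.shift_succ (j' + 1)]
      exact hC'.ren (.shift N₀ k 1)
  target B hB := by
    obtain ⟨C, hC, hC'⟩ := h.target hB
    refine ⟨C.shift 1, ?_, ?_⟩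
    · rw [Ty.shift_succ (k + 1)]
      exact hC.ren (.shift N₀ k 1)
    · rw [Nrm.shift_succ]
      exact hC'.ren hSg (.succ A' Γ')

/-- Hereditary substitution at type `α₀` preserves LF typing of normal terms. -/
def LFPreserves (Sg : Sig) (α₀ : STy) : Prop :=
  ∀ ⦃Γ Γ' k N₀ N A N' A'⦄, LFSub Sg Γ Γ' k N₀ α₀ → LFCheck (Sig.erase Sg) Γ N A →
    TySWf Sg (LFCtx.simple Γ) A → HSubstN N₀ k α₀ N N' → HSubstA N₀ k α₀ A A' →
    LFCheck (Sig.erase Sg) Γ' N' A'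

mutual
theorem LFSynth.hsubst_of_preserves {Sg : Sig} (hSg : SigSWf Sg) {α₀ : STy}
    (ih : ∀ α : STy, sizeOf α < sizeOf α₀ → LFPreserves Sg α) {Γ Γ' : LFCtx} {k : ℕ} {N₀ : Nrm}
    (hs : LFSub Sg Γ Γ' k N₀ α₀) {R : Atm} {A A' : Ty} : LFSynth (Sig.erase Sg) Γ R A →
    HSubstA N₀ k α₀ A A' →
    (∀ R', HSubstRR N₀ k α₀ R R' → LFSynth (Sig.erase Sg) Γ' R' A') ∧
      ∀ N' β, HSubstRN N₀ k α₀ R N' β → LFCheck (Sig.erase Sg) Γ' N' A'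
  | .const h, hA => by
    obtain rfl := hA.unique ((hSg.tm (tm_mem_erase.1 h)).hsubstA_self (Nat.zero_le _))
    constructor
    · rintro _ ⟨⟩
      exact .const h
    · rintro _ _ ⟨⟩
  | .var h, hA => by
    constructor
    · intro R' hR
      obtain ⟨i', rfl, hi⟩ := hR.varSub
      obtain ⟨B, hB, hB'⟩ := hs.var hi h
      rw [hA.unique hB']
      exact .var hB
    · rintro N' β ⟨⟩
      obtain ⟨B, hB, hB'⟩ := hs.target h
      rwa [hA.unique hB]
  | .app h₁ h₂ h₃, hA => by
    cases h₁.swf hSg hs.swf with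
    | pi hA₂ hB =>
      obtain ⟨A₂', hA₂', hA₂s⟩ := hA₂.hsubst hs.ssub
      obtain ⟨B', hB', hBs⟩ := hB.hsubst (hs.ssub.up _)
      obtain ⟨ih₁, ih₂⟩ := LFSynth.hsubst_of_preserves hSg ih hs h₁ (.pi hA₂' hB')
      constructor
      · rintro _ (_ | _ | _ | ⟨hR, hN⟩)
        have hN' := LFCheck.hsubst_of_preserves hSg ih hs h₂ hA₂ hN hA₂'
        obtain ⟨C, hC, hC'⟩ := h₃.comp hN (by rwa [Nat.zero_add])
        rw [Nat.zero_add] at hC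
        obtain rfl := hA.unique hC
        exact .app (ih₁ _ hR) hN' (by rwa [hA₂'.simple_eq])
      · rintro _ _ (_ | ⟨hR, hN, hb⟩)
        have hN' := LFCheck.hsubst_of_preserves hSg ih hs h₂ hA₂ hN hA₂'
        obtain ⟨C, hC, hC'⟩ := h₃.comp hN (by rwa [Nat.zero_add])
        rw [Nat.zero_add] at hC
        obtain rfl := hA.unique hC
        obtain ⟨he, -⟩ := h₁.hasSTy.of_hsubstRN hs.ssub hR
        cases he
        have hle := hR.sizeOf_le
        simp only [STy.arrow.sizeOf_spec] at hle
        cases ih₂ _ _ hR with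
        | lam hM =>
          have hz := LFSub.zero hs.swf' hA₂s hN'
          rw [hA₂'.simple_eq] at hz
          exact ih _ (by omega) hz hM (by rwa [← hA₂'.simple_eq] at hBs) hb hC'
theorem LFCheck.hsubst_of_preserves {Sg : Sig} (hSg : SigSWf Sg) {α₀ : STy}
    (ih : ∀ α : STy, sizeOf α < sizeOf α₀ → LFPreserves Sg α) {Γ Γ' : LFCtx} {k : ℕ} {N₀ : Nrm}
    (hs : LFSub Sg Γ Γ' k N₀ α₀) {N N' : Nrm} {A A' : Ty} : LFCheck (Sig.erase Sg) Γ N A →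
    TySWf Sg (LFCtx.simple Γ) A → HSubstN N₀ k α₀ N N' → HSubstA N₀ k α₀ A A' →
    LFCheck (Sig.erase Sg) Γ' N' A'
  | .atm h, _, hN, hA => by
    obtain ⟨ih₁, ih₂⟩ := LFSynth.hsubst_of_preserves hSg ih hs h hA
    cases hA
    cases hN with
    | atm hN => exact .atm (ih₁ _ hN)
    | atmNorm hN => exact ih₂ _ _ hN
  | .lam h, hwf, hN, hA => by
    cases hwf with | pi hwf₁ hwf₂ =>
    cases hN with | lam hN =>
    cases hA with | pi hA hB =>
    exact .lam (LFCheck.hsubst_of_preserves hSg ih (hs.up hSg hwf₁ hA) h hwf₂ hN hB)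
end

theorem lfPreserves {Sg : Sig} (hSg : SigSWf Sg) (α₀ : STy) : LFPreserves Sg α₀ := by
  induction hn : sizeOf α₀ using Nat.strong_induction_on generalizing α₀ with
  | _ n ih =>
    intro Γ Γ' k N₀ N A N' A' hs h
    exact h.hsubst_of_preserves hSg (fun α hα => ih _ (hn ▸ hα) α rfl) hs

/-! ### Substitution into LFR terms -/

/-- Substituting `N₀` for the variable `k` leads from the LFR context `Γ` to the LFR context
`Γ'`. -/
structure CtxSub (Sg : Sig) (Γ Γ' : Ctx) (k : ℕ) (N₀ : Nrm) (α₀ : STy) : Prop where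
  ssub : SSub Sg (Ctx.simple Γ) (Ctx.simple Γ') k N₀ α₀
  swf : CtxSWf Sg Γ
  swf' : CtxSWf Sg Γ'
  var : ∀ ⦃i i' S A⦄, VarSub k i i' → Γ[i]? = some (S, A) →
    ∃ T B, Γ'[i']? = some (T, B) ∧ HSubstS N₀ k α₀ (S.shift (i + 1)) (T.shift (i' + 1))
  target : ∀ ⦃S A⦄, Γ[k]? = some (S, A) →
    ∃ T, HSubstS N₀ k α₀ (S.shift (k + 1)) T ∧ Check Sg Γ' (N₀.shift k) T

theorem CtxSub.zero {Sg : Sig} {Γ : Ctx} {N₀ : Nrm} {S₀ : Srt} {A₀ : Ty} (hΓ : CtxSWf Sg Γ)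
    (hS : SrtSRefines Sg (Ctx.simple Γ) S₀ A₀.simple)
    (hN : NrmHasSTy Sg (Ctx.simple Γ) N₀ A₀.simple) (h : Check Sg Γ N₀ S₀) :
    CtxSub Sg ((S₀, A₀) :: Γ) Γ 0 N₀ A₀.simple where
  ssub := .zero hN
  swf := hΓ.cons hS
  swf' := hΓ
  var i i' S A hi hA := by
    obtain rfl := varSub_zero hi
    exact ⟨S, A, hA, .vacuous (varSub_shift (Nat.zero_le _)) S⟩
  target S A hA := by
    cases hA
    refine ⟨S₀.shift 0, .vacuous (varSub_shift le_rfl) S₀, ?_⟩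
    rwa [Nrm.shift_zero, Srt.shift_zero]

theorem CtxSub.up {Sg : Sig} (hSg : SigSWf Sg) {Γ Γ' : Ctx} {k : ℕ} {N₀ : Nrm} {α₀ : STy}
    (h : CtxSub Sg Γ Γ' k N₀ α₀) {S S' : Srt} {A A' : Ty}
    (hS : SrtSRefines Sg (Ctx.simple Γ) S A.simple) (hS' : HSubstS N₀ k α₀ S S')
    (hA' : HSubstA N₀ k α₀ A A') :
    CtxSub Sg ((S, A) :: Γ) ((S', A') :: Γ') (k + 1) N₀ α₀ where
  ssub := by
    change SSub Sg (A.simple :: _) (A'.simple :: _) (k + 1) N₀ α₀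
    rw [hA'.simple_eq]
    exact h.ssub.up _
  swf := h.swf.cons hS
  swf' := h.swf'.cons (by rw [hA'.simple_eq]; exact hS.of_hsubst h.ssub hS')
  var i i' T B hi hB := by
    rcases hi.succ_cases with ⟨rfl, rfl⟩ | ⟨j, j', rfl, rfl, hj⟩
    · cases hB
      exact ⟨S', A', rfl, hS'.ren (.shift N₀ k 1)⟩
    · obtain ⟨T', B', hC, hC'⟩ := h.var hj hB
      refine ⟨T', B', hC, ?_⟩
      rw [Srt.shift_succ (j + 1), Srt.shift_succ (j' + 1)]
      exact hC'.ren (.shift N₀ k 1)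
  target T B hB := by
    obtain ⟨T', hC, hC'⟩ := h.target hB
    refine ⟨T'.shift 1, ?_, ?_⟩
    · rw [Srt.shift_succ (k + 1)]
      exact hC.ren (.shift N₀ k 1)
    · rw [Nrm.shift_succ]
      exact hC'.ren hSg (.succ S' A' Γ')

theorem Subsort.trans {Sg : Sig} {Q₁ Q₂ Q₃ : ASrt} (h : Subsort Sg Q₁ Q₂)
    (h' : Subsort Sg Q₂ Q₃) : Subsort Sg Q₁ Q₃ := by
  induction h with
  | refl => exact h'
  | step h _ ih => exact .step h (ih h')

theorem SubStep.hsubst {Sg : Sig} {N₀ : Nrm} {k : ℕ} {α₀ : STy} {Q₁ Q₂ Q₁' : ASrt}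
    (h : SubStep Sg Q₁ Q₂) (h₁ : HSubstQ N₀ k α₀ Q₁ Q₁') :
    ∃ Q₂', HSubstQ N₀ k α₀ Q₂ Q₂' ∧ SubStep Sg Q₁' Q₂' := by
  induction h generalizing Q₁' with
  | decl h => cases h₁; exact ⟨_, .const, .decl h⟩
  | app _ ih =>
    cases h₁ with
    | app hQ hN =>
      obtain ⟨_, h, h'⟩ := ih hQ
      exact ⟨_, .app h hN, .app h'⟩

theorem Subsort.hsubst {Sg : Sig} {N₀ : Nrm} {k : ℕ} {α₀ : STy} {Q₁ Q₂ Q₁' Q₂' : ASrt}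
    (h : Subsort Sg Q₁ Q₂) (h₁ : HSubstQ N₀ k α₀ Q₁ Q₁') (h₂ : HSubstQ N₀ k α₀ Q₂ Q₂') :
    Subsort Sg Q₁' Q₂' := by
  induction h generalizing Q₁' with
  | refl => rw [h₁.unique h₂]; exact .refl
  | step h _ ih =>
    obtain ⟨_, h', h''⟩ := h.hsubst h₁
    exact .step h'' (ih h' h₂)

/-- Hereditary substitution at type `α₀` preserves sorts of normal terms. -/
def Preserves (Sg : Sig) (α₀ : STy) : Prop :=
  ∀ ⦃Γ Γ' k N₀ N S β N' S'⦄, CtxSub Sg Γ Γ' k N₀ α₀ → Check Sg Γ N S →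
    NrmHasSTy Sg (Ctx.simple Γ) N β → SrtSRefines Sg (Ctx.simple Γ) S β →
    HSubstN N₀ k α₀ N N' → HSubstS N₀ k α₀ S S' → Check Sg Γ' N' S'

mutual
theorem Synth.hsubst_of_preserves {Sg : Sig} (hSg : SigSWf Sg) {α₀ : STy}
    (ih : ∀ α : STy, sizeOf α < sizeOf α₀ → Preserves Sg α) {Γ Γ' : Ctx} {k : ℕ} {N₀ : Nrm}
    (hs : CtxSub Sg Γ Γ' k N₀ α₀) {R : Atm} {S S' : Srt} {β : STy} : Synth Sg Γ R S →
    AtmHasSTy Sg (Ctx.simple Γ) R β → HSubstS N₀ k α₀ S S' →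
    (∀ R', HSubstRR N₀ k α₀ R R' → Synth Sg Γ' R' S') ∧
      ∀ N' β, HSubstRN N₀ k α₀ R N' β → Check Sg Γ' N' S'
  | .const h, _, hS => by
    obtain ⟨_, _, hS'⟩ := hSg.tmSrt h
    obtain rfl := hS.unique (hS'.hsubstS_self (Nat.zero_le _))
    constructor
    · rintro _ ⟨⟩
      exact .const h
    · rintro _ _ ⟨⟩
  | .var h, _, hS => by
    constructor
    · intro R' hR
      obtain ⟨i', rfl, hi⟩ := hR.varSub
      obtain ⟨T, B, hB, hB'⟩ := hs.var hi h
      rw [hS.unique hB']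
      exact .var hB
    · rintro N' β ⟨⟩
      obtain ⟨T, hT, hT'⟩ := hs.target h
      rwa [hS.unique hT]
  | .app h₁ h₂ h₃, hR, hS => by
    cases hR with | app hR₁ hN₂ =>
    cases h₁.srefines hSg hs.swf hR₁ with
    | pi hS₂ hA₂ hT =>
      obtain ⟨S₂', hS₂', hS₂s⟩ := hS₂.hsubst hs.ssub
      obtain ⟨A₂', hA₂', hA₂s⟩ := hA₂.hsubst hs.ssub
      obtain ⟨T', hT', hTs⟩ := hT.hsubst (hs.ssub.up _)
      obtain ⟨ih₁, ih₂⟩ :=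
        Synth.hsubst_of_preserves hSg ih hs h₁ hR₁ (.pi hS₂' hA₂' hT')
      constructor
      · rintro _ (_ | _ | _ | ⟨hR, hN⟩)
        have hN' := Check.hsubst_of_preserves hSg ih hs h₂ hN₂ hS₂ hN hS₂'
        obtain ⟨C, hC, hC'⟩ := h₃.comp hN (by rwa [Nat.zero_add])
        rw [Nat.zero_add] at hC
        obtain rfl := hS.unique hC
        exact .app (ih₁ _ hR) hN' (by rwa [hA₂'.simple_eq])
      · rintro _ _ (_ | ⟨hR, hN, hb⟩)
        have hN' := Check.hsubst_of_preserves hSg ih hs h₂ hN₂ hS₂ hN hS₂'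
        obtain ⟨C, hC, hC'⟩ := h₃.comp hN (by rwa [Nat.zero_add])
        rw [Nat.zero_add] at hC
        obtain rfl := hS.unique hC
        obtain ⟨he, hM'⟩ := hR₁.of_hsubstRN hs.ssub hR
        cases he
        have hle := hR.sizeOf_le
        simp only [STy.arrow.sizeOf_spec] at hle
        cases hM' with | lam hM' =>
        cases ih₂ _ _ hR with
        | lam hM =>
          have hz := CtxSub.zero (A₀ := A₂') hs.swf' (by rwa [hA₂'.simple_eq])
            (by rw [hA₂'.simple_eq]; exact hN₂.of_hsubst hs.ssub hN) hN'
          rw [hA₂'.simple_eq] at hz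
          rw [← hA₂'.simple_eq] at hM' hTs
          exact ih _ (by omega) hz hM hM' hTs hb hC'
  | .interE₁ h, hR, hS => by
    cases h.srefines hSg hs.swf hR with
    | inter _ hT =>
      obtain ⟨_, hT, _⟩ := hT.hsubst hs.ssub
      obtain ⟨ih₁, ih₂⟩ := Synth.hsubst_of_preserves hSg ih hs h hR (.inter hS hT)
      refine ⟨fun R' h => .interE₁ (ih₁ R' h), fun N' β h => ?_⟩
      cases ih₂ N' β h with | inter h _ => exact h
  | .interE₂ h, hR, hS => by
    cases h.srefines hSg hs.swf hR with
    | inter hT _ =>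
      obtain ⟨_, hT, _⟩ := hT.hsubst hs.ssub
      obtain ⟨ih₁, ih₂⟩ := Synth.hsubst_of_preserves hSg ih hs h hR (.inter hT hS)
      refine ⟨fun R' h => .interE₂ (ih₁ R' h), fun N' β h => ?_⟩
      cases ih₂ N' β h with | inter _ h => exact h
theorem Check.hsubst_of_preserves {Sg : Sig} (hSg : SigSWf Sg) {α₀ : STy}
    (ih : ∀ α : STy, sizeOf α < sizeOf α₀ → Preserves Sg α) {Γ Γ' : Ctx} {k : ℕ} {N₀ : Nrm}
    (hs : CtxSub Sg Γ Γ' k N₀ α₀) {N N' : Nrm} {S S' : Srt} {β : STy} : Check Sg Γ N S →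
    NrmHasSTy Sg (Ctx.simple Γ) N β → SrtSRefines Sg (Ctx.simple Γ) S β →
    HSubstN N₀ k α₀ N N' → HSubstS N₀ k α₀ S S' → Check Sg Γ' N' S'
  | .switch h hle, hβ, hwf, hN, hS => by
    cases hβ with | atm hβ =>
    cases hS with | atm hQ =>
    cases h.srefines hSg hs.swf hβ with | atm hQ' =>
    obtain ⟨_, hQ', _⟩ := hQ'.hsubst hs.ssub
    obtain ⟨ih₁, ih₂⟩ := Synth.hsubst_of_preserves hSg ih hs h hβ (.atm hQ')
    have hle' := hle.hsubst hQ' hQ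
    cases hN with
    | atm hN => exact .switch (ih₁ _ hN) hle'
    | atmNorm hN => cases ih₂ _ _ hN with | switch h hle => exact .switch h (hle.trans hle')
  | .lam h, hβ, hwf, hN, hS => by
    cases hwf with | pi hwf₁ hwf₂ hwf₃ =>
    cases hβ with | lam hβ =>
    cases hN with | lam hN =>
    cases hS with | pi hS hA hT =>
    exact .lam (Check.hsubst_of_preserves hSg ih (hs.up hSg hwf₁ hS hA) h hβ hwf₃ hN hT)
  | .top, _, _, _, hS => by cases hS; exact .top
  | .inter h₁ h₂, hβ, hwf, hN, hS => by
    cases hwf with | inter hwf₁ hwf₂ =>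
    cases hS with | inter hS hT =>
    exact .inter (Check.hsubst_of_preserves hSg ih hs h₁ hβ hwf₁ hN hS)
      (Check.hsubst_of_preserves hSg ih hs h₂ hβ hwf₂ hN hT)
end

theorem preserves {Sg : Sig} (hSg : SigSWf Sg) (α₀ : STy) : Preserves Sg α₀ := by
  induction hn : sizeOf α₀ using Nat.strong_induction_on generalizing α₀ with
  | _ n ih =>
    intro Γ Γ' k N₀ N S β N' S' hs h
    exact h.hsubst_of_preserves hSg (fun α hα => ih _ (hn ▸ hα) α rfl) hs

/-! ### Substitution into types, kinds, sorts and classes -/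

section Families

variable {Sg : Sig} {k : ℕ} {N₀ : Nrm} {α₀ : STy}

theorem LFSynthKind.hsubst (hSg : SigSWf Sg) {Γ Γ' : LFCtx} (hs : LFSub Sg Γ Γ' k N₀ α₀)
    {P P' : ATy} {K K' : Kind} (h : LFSynthKind (Sig.erase Sg) Γ P K)
    (hP : HSubstP N₀ k α₀ P P') (hK : HSubstK N₀ k α₀ K K') :
    LFSynthKind (Sig.erase Sg) Γ' P' K' := by
  induction P generalizing P' K K' with
  | const a =>
    cases h with
    | const h =>
      cases hP
      rw [hK.unique ((hSg.ty (ty_mem_erase.1 h)).hsubstK_self (Nat.zero_le _))]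
      exact .const h
  | app P N ih =>
    cases h with | app h₁ h₂ h₃ =>
    cases hP with | app hP hN =>
    cases h₁.swf hSg with | pi hA hK₁ =>
    obtain ⟨A', hA', -⟩ := hA.hsubst hs.ssub
    obtain ⟨K₁', hK₁', -⟩ := hK₁.hsubst (hs.ssub.up _)
    obtain ⟨C, hC, hC'⟩ := h₃.comp hN (by rwa [Nat.zero_add])
    rw [Nat.zero_add] at hC
    obtain rfl := hK.unique hC
    exact .app (ih h₁ hP (.pi hA' hK₁')) (lfPreserves hSg α₀ hs h₂ hA hN hA')
      (by rwa [hA'.simple_eq])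

theorem LFTyWf.hsubst (hSg : SigSWf Sg) {Γ Γ' : LFCtx} (hs : LFSub Sg Γ Γ' k N₀ α₀)
    {A A' : Ty} (h : LFTyWf (Sig.erase Sg) Γ A) (hA : HSubstA N₀ k α₀ A A') :
    LFTyWf (Sig.erase Sg) Γ' A' := by
  induction A generalizing Γ Γ' k A' with
  | atm P =>
    cases h with | atm h =>
    cases hA with | atm hA =>
    exact .atm (h.hsubst hSg hs hA .type)
  | pi A B ihA ihB =>
    cases h with | pi h₁ h₂ =>
    cases hA with | pi hA hB =>
    exact .pi (ihA hs h₁ hA) (ihB (hs.up hSg h₁.swf hA) h₂ hB)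

theorem LFKindWf.hsubst (hSg : SigSWf Sg) {Γ Γ' : LFCtx} (hs : LFSub Sg Γ Γ' k N₀ α₀)
    {K K' : Kind} (h : LFKindWf (Sig.erase Sg) Γ K) (hK : HSubstK N₀ k α₀ K K') :
    LFKindWf (Sig.erase Sg) Γ' K' := by
  induction K generalizing Γ Γ' k K' with
  | type => cases hK; exact .type
  | pi A K ih =>
    cases h with | pi h₁ h₂ =>
    cases hK with | pi hA hK =>
    exact .pi (h₁.hsubst hSg hs hA) (ih (hs.up hSg h₁.swf hA) h₂ hK)

theorem SynthCls.hsubst (hSg : SigSWf Sg) {Γ Γ' : Ctx} (hs : CtxSub Sg Γ Γ' k N₀ α₀)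
    {Q Q' : ASrt} {P P' : ATy} {L L' : Cls} {l : List STy} (h : SynthCls Sg Γ Q P L)
    (hl : ATyHasSKind Sg (Ctx.simple Γ) P l) (hQ : HSubstQ N₀ k α₀ Q Q')
    (hP : HSubstP N₀ k α₀ P P') (hL : HSubstL N₀ k α₀ L L') : SynthCls Sg Γ' Q' P' L' := by
  induction h generalizing Q' P' L' l with
  | const h =>
    cases hQ
    cases hP
    obtain ⟨_, _, hL'⟩ := hSg.srt h
    rw [hL.unique (hL'.hsubstL_self (Nat.zero_le _))]
    exact .const h
  | app h₁ h₂ h₃ ih =>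
    cases hl with | app hl hα =>
    cases hQ with | app hQ hN =>
    cases hP with | app hP hN₁ =>
    obtain rfl := hN.unique hN₁
    cases h₁.srefines hSg hl with | pi hS hA hL₁ =>
    obtain ⟨S', hS', -⟩ := hS.hsubst hs.ssub
    obtain ⟨A', hA', -⟩ := hA.hsubst hs.ssub
    obtain ⟨L₁', hL₁', -⟩ := hL₁.hsubst (hs.ssub.up _)
    obtain ⟨C, hC, hC'⟩ := h₃.comp hN (by rwa [Nat.zero_add])
    rw [Nat.zero_add] at hC
    obtain rfl := hL.unique hC
    exact .app (ih hl hQ hP (.pi hS' hA' hL₁')) (preserves hSg α₀ hs h₂ hα hS hN hS')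
      (by rwa [hA'.simple_eq])
  | interE₁ h ih =>
    cases h.srefines hSg hl with | inter _ h₂ =>
    obtain ⟨_, h₂, -⟩ := h₂.hsubst hs.ssub
    exact .interE₁ (ih hl hQ hP (.inter hL h₂))
  | interE₂ h ih =>
    cases h.srefines hSg hl with | inter h₁ _ =>
    obtain ⟨_, h₁, -⟩ := h₁.hsubst hs.ssub
    exact .interE₂ (ih hl hQ hP (.inter h₁ hL))

theorem Refines.hsubst (hSg : SigSWf Sg) {Γ Γ' : Ctx} (hs : CtxSub Sg Γ Γ' k N₀ α₀)
    {S S' : Srt} {A A' : Ty} (h : Refines Sg Γ S A) (hwf : TySWf Sg (Ctx.simple Γ) A)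
    (hS : HSubstS N₀ k α₀ S S') (hA : HSubstA N₀ k α₀ A A') : Refines Sg Γ' S' A' := by
  induction h generalizing Γ' k S' A' with
  | atm h =>
    cases hwf with | atm hwf =>
    cases hS with | atm hQ =>
    cases hA with | atm hP =>
    exact .atm (h.hsubst hSg hs hwf hQ hP .sort)
  | pi h₁ _ ih₁ ih₂ =>
    cases hwf with | pi hwf₁ hwf₂ =>
    cases hS with | pi hS₁ hA₁ hS₂ =>
    cases hA with | pi hA₁' hA₂ =>
    obtain rfl := hA₁.unique hA₁'
    exact .pi (ih₁ hs hwf₁ hS₁ hA₁)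
      (ih₂ (hs.up hSg (h₁.srefines hwf₁) hS₁ hA₁) hwf₂ hS₂ hA₂)
  | top => cases hS; exact .top
  | inter _ _ ih₁ ih₂ =>
    cases hS with | inter hS₁ hS₂ =>
    exact .inter (ih₁ hs hwf hS₁ hA) (ih₂ hs hwf hS₂ hA)

theorem RefinesCls.hsubst (hSg : SigSWf Sg) {Γ Γ' : Ctx} (hs : CtxSub Sg Γ Γ' k N₀ α₀)
    {L L' : Cls} {K K' : Kind} (h : RefinesCls Sg Γ L K) (hwf : KindSWf Sg (Ctx.simple Γ) K)
    (hL : HSubstL N₀ k α₀ L L') (hK : HSubstK N₀ k α₀ K K') : RefinesCls Sg Γ' L' K' := by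
  induction h generalizing Γ' k L' K' with
  | sort => cases hL; cases hK; exact .sort
  | pi h₁ _ ih =>
    cases hwf with | pi hwf₁ hwf₂ =>
    cases hL with | pi hS hA hL =>
    cases hK with | pi hA' hK =>
    obtain rfl := hA.unique hA'
    exact .pi (h₁.hsubst hSg hs hwf₁ hS hA)
      (ih (hs.up hSg (h₁.srefines hwf₁) hS hA) hwf₂ hL hK)
  | top => cases hL; exact .top
  | inter _ _ ih₁ ih₂ =>
    cases hL with | inter hL₁ hL₂ =>
    exact .inter (ih₁ hs hwf hL₁ hK) (ih₂ hs hwf hL₂ hK)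

end Families

/-! ### Substitution into contexts -/

theorem exists_hsubstCtx {Sg : Sig} (hSg : SigSWf Sg) {ΓL : Ctx} {N₀ : Nrm} {S₀ : Srt} {A₀ : Ty}
    (hN₀ : Check Sg ΓL N₀ S₀) (hN₀' : LFCheck (Sig.erase Sg) (Ctx.erase ΓL) N₀ A₀) (ΓR : Ctx)
    (hΓ : CtxWf Sg (ΓR ++ (S₀, A₀) :: ΓL))
    (hΓ' : LFCtxWf (Sig.erase Sg) (Ctx.erase (ΓR ++ (S₀, A₀) :: ΓL))) :
    ∃ ΓR', HSubstCtx N₀ A₀.simple ΓR ΓR' ∧ CtxWf Sg (ΓR' ++ ΓL) ∧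
      LFCtxWf (Sig.erase Sg) (Ctx.erase (ΓR' ++ ΓL)) ∧
      CtxSub Sg (ΓR ++ (S₀, A₀) :: ΓL) (ΓR' ++ ΓL) ΓR.length N₀ A₀.simple ∧
      LFSub Sg (Ctx.erase (ΓR ++ (S₀, A₀) :: ΓL)) (Ctx.erase (ΓR' ++ ΓL)) ΓR.length N₀
        A₀.simple := by
  induction ΓR with
  | nil =>
    cases hΓ with | cons hΓ hS =>
    cases hΓ' with | cons hΓ' hA =>
    exact ⟨[], .nil, hΓ, hΓ', .zero (hΓ.swf hΓ') (hS.srefines hA.swf) hN₀'.hasSTy hN₀,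
      .zero hΓ'.swf hA.swf hN₀'⟩
  | cons D ΓR ih =>
    obtain ⟨S, A⟩ := D
    cases hΓ with | cons hΓ hS =>
    cases hΓ' with | cons hΓ' hA =>
    obtain ⟨ΓR', hR, hwf, hwf', hs, hs'⟩ := ih hΓ hΓ'
    have hSs := hS.srefines hA.swf
    obtain ⟨S', hS', -⟩ := hSs.hsubst hs.ssub
    obtain ⟨A', hA', -⟩ := hA.swf.hsubst hs'.ssub
    exact ⟨(S', A') :: ΓR', .cons hR hS' hA', .cons hwf (hS.hsubst hSg hs hA.swf hS' hA'),
      .cons hwf' (hA.hsubst hSg hs' hA'), hs.up hSg hSs hS' hA', hs'.up hSg hA.swf hA'⟩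

end LFR

open LFR in
theorem mainTheorem2
    (Sg : Sig) (hSg : SigWf Sg)
    (ΓL ΓR : Ctx) (N₀ : Nrm) (S₀ : Srt) (A₀ : Ty)
    (hN₀ : Check Sg ΓL N₀ S₀)
    (hN₀' : LFCheck (Sig.erase Sg) (Ctx.erase ΓL) N₀ A₀)
    (hΓ : CtxWf Sg (ΓR ++ (S₀, A₀) :: ΓL))
    (hΓ' : LFCtxWf (Sig.erase Sg) (Ctx.erase (ΓR ++ (S₀, A₀) :: ΓL))) :
    -- contexts
    ∃ ΓR' : Ctx, HSubstCtx N₀ A₀.simple ΓR ΓR' ∧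
      CtxWf Sg (ΓR' ++ ΓL) ∧
      LFCtxWf (Sig.erase Sg) (Ctx.erase (ΓR' ++ ΓL)) ∧
      -- normal terms
      (∀ (N : Nrm) (S : Srt) (A : Ty),
        Refines Sg (ΓR ++ (S₀, A₀) :: ΓL) S A →
        LFTyWf (Sig.erase Sg) (Ctx.erase (ΓR ++ (S₀, A₀) :: ΓL)) A →
        Check Sg (ΓR ++ (S₀, A₀) :: ΓL) N S →
        LFCheck (Sig.erase Sg) (Ctx.erase (ΓR ++ (S₀, A₀) :: ΓL)) N A →
        ∃ (N' : Nrm) (S' : Srt) (A' : Ty),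
          HSubstS N₀ ΓR.length A₀.simple S S' ∧
          HSubstA N₀ ΓR.length A₀.simple A A' ∧
          Refines Sg (ΓR' ++ ΓL) S' A' ∧
          LFTyWf (Sig.erase Sg) (Ctx.erase (ΓR' ++ ΓL)) A' ∧
          HSubstN N₀ ΓR.length A₀.simple N N' ∧
          Check Sg (ΓR' ++ ΓL) N' S' ∧
          LFCheck (Sig.erase Sg) (Ctx.erase (ΓR' ++ ΓL)) N' A') ∧
      -- atomic terms
      (∀ (R : Atm) (S : Srt) (A : Ty),
        Synth Sg (ΓR ++ (S₀, A₀) :: ΓL) R S →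
        LFSynth (Sig.erase Sg) (Ctx.erase (ΓR ++ (S₀, A₀) :: ΓL)) R A →
        ∃ (S' : Srt) (A' : Ty),
          HSubstS N₀ ΓR.length A₀.simple S S' ∧
          HSubstA N₀ ΓR.length A₀.simple A A' ∧
          ((∃ R' : Atm, HSubstRR N₀ ΓR.length A₀.simple R R' ∧
              Synth Sg (ΓR' ++ ΓL) R' S' ∧
              LFSynth (Sig.erase Sg) (Ctx.erase (ΓR' ++ ΓL)) R' A') ∨
            (∃ N' : Nrm, HSubstRN N₀ ΓR.length A₀.simple R N' A'.simple ∧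
              Check Sg (ΓR' ++ ΓL) N' S' ∧
              LFCheck (Sig.erase Sg) (Ctx.erase (ΓR' ++ ΓL)) N' A'))) ∧
      -- sorts and types
      (∀ (S : Srt) (A : Ty),
        Refines Sg (ΓR ++ (S₀, A₀) :: ΓL) S A →
        LFTyWf (Sig.erase Sg) (Ctx.erase (ΓR ++ (S₀, A₀) :: ΓL)) A →
        ∃ (S' : Srt) (A' : Ty),
          HSubstS N₀ ΓR.length A₀.simple S S' ∧
          HSubstA N₀ ΓR.length A₀.simple A A' ∧
          Refines Sg (ΓR' ++ ΓL) S' A' ∧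
          LFTyWf (Sig.erase Sg) (Ctx.erase (ΓR' ++ ΓL)) A') ∧
      -- atomic sort families and atomic type families
      (∀ (Q : ASrt) (P : ATy) (L : Cls) (K : Kind),
        SynthCls Sg (ΓR ++ (S₀, A₀) :: ΓL) Q P L →
        LFSynthKind (Sig.erase Sg) (Ctx.erase (ΓR ++ (S₀, A₀) :: ΓL)) P K →
        ∃ (Q' : ASrt) (P' : ATy) (L' : Cls) (K' : Kind),
          HSubstQ N₀ ΓR.length A₀.simple Q Q' ∧
          HSubstP N₀ ΓR.length A₀.simple P P' ∧
          HSubstL N₀ ΓR.length A₀.simple L L' ∧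
          HSubstK N₀ ΓR.length A₀.simple K K' ∧
          SynthCls Sg (ΓR' ++ ΓL) Q' P' L' ∧
          LFSynthKind (Sig.erase Sg) (Ctx.erase (ΓR' ++ ΓL)) P' K') ∧
      -- classes and kinds
      (∀ (L : Cls) (K : Kind),
        RefinesCls Sg (ΓR ++ (S₀, A₀) :: ΓL) L K →
        LFKindWf (Sig.erase Sg) (Ctx.erase (ΓR ++ (S₀, A₀) :: ΓL)) K →
        ∃ (L' : Cls) (K' : Kind),
          HSubstL N₀ ΓR.length A₀.simple L L' ∧
          HSubstK N₀ ΓR.length A₀.simple K K' ∧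
          RefinesCls Sg (ΓR' ++ ΓL) L' K' ∧
          LFKindWf (Sig.erase Sg) (Ctx.erase (ΓR' ++ ΓL)) K') := by
  have hSg := hSg.swf
  obtain ⟨ΓR', hR, hwf, hwf', hs, hs'⟩ := exists_hsubstCtx hSg hN₀ hN₀' ΓR hΓ hΓ'
  refine ⟨ΓR', hR, hwf, hwf', ?_, ?_, ?_, ?_, ?_⟩
  · intro N S A hS hA hNS hNA
    have hSs := hS.srefines hA.swf
    obtain ⟨S', hS', -⟩ := hSs.hsubst hs.ssub
    obtain ⟨A', hA', -⟩ := hA.swf.hsubst hs'.ssub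
    obtain ⟨N', hN', -⟩ := hNA.hasSTy.hsubst hs'.ssub
    exact ⟨N', S', A', hS', hA', hS.hsubst hSg hs hA.swf hS' hA', hA.hsubst hSg hs' hA', hN',
      preserves hSg _ hs hNS hNA.hasSTy hSs hN' hS', lfPreserves hSg _ hs' hNA hA.swf hN' hA'⟩
  · intro R S A hRS hRA
    obtain ⟨S', hS', -⟩ := (hRS.srefines hSg hs.swf hRA.hasSTy).hsubst hs.ssub
    obtain ⟨A', hA', -⟩ := (hRA.swf hSg hs'.swf).hsubst hs'.ssub
    obtain ⟨h₁, h₂⟩ :=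
      hRS.hsubst_of_preserves hSg (fun α _ => preserves hSg α) hs hRA.hasSTy hS'
    obtain ⟨h₁', h₂'⟩ := hRA.hsubst_of_preserves hSg (fun α _ => lfPreserves hSg α) hs' hA'
    refine ⟨S', A', hS', hA', ?_⟩
    rcases hRA.hasSTy.hsubst hs'.ssub with ⟨R', hR', -⟩ | ⟨N', hN', -⟩
    · exact .inl ⟨R', hR', h₁ R' hR', h₁' R' hR'⟩
    · exact .inr ⟨N', by rwa [hA'.simple_eq], h₂ N' _ hN', h₂' N' _ hN'⟩
  · intro S A hS hA
    obtain ⟨S', hS', -⟩ := (hS.srefines hA.swf).hsubst hs.ssub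
    obtain ⟨A', hA', -⟩ := hA.swf.hsubst hs'.ssub
    exact ⟨S', A', hS', hA', hS.hsubst hSg hs hA.swf hS' hA', hA.hsubst hSg hs' hA'⟩
  · intro Q P L K hQ hP
    obtain ⟨Q', hQ', -⟩ := (hQ.hasSKind hP.hasSKind).hsubst hs.ssub
    obtain ⟨P', hP', -⟩ := hP.hasSKind.hsubst hs'.ssub
    obtain ⟨L', hL', -⟩ := (hQ.srefines hSg hP.hasSKind).hsubst hs.ssub
    obtain ⟨K', hK', -⟩ := (hP.swf hSg).hsubst hs'.ssub
    exact ⟨Q', P', L', K', hQ', hP', hL', hK', hQ.hsubst hSg hs hP.hasSKind hQ' hP' hL',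
      hP.hsubst hSg hs' hP' hK'⟩
  · intro L K hL hK
    obtain ⟨L', hL', -⟩ := (hL.srefines hK.swf).hsubst hs.ssub
    obtain ⟨K', hK', -⟩ := hK.swf.hsubst hs'.ssub
    exact ⟨L', K', hL', hK', hL.hsubst hSg hs hK.swf hL' hK', hK.hsubst hSg hs' hK'⟩
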